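/- Let $n\ge 1$, $\vec p=(p_1,\dots,p_n)$ with $1<p_i<\infty$, let $\vec p\,'=(p_1',\dots,p_n')$ with $p_i'=p_i/(p_i-1)$, and let $$-\frac1n\sum_{i=1}^n\frac1{p_i}<\lambda<0 .$$ Assume moreover that $\lambda\neq-\frac1n\sum_{i=1}^n\frac1{p_i'}$ unless $p_1=\dots=p_n$. For exponents $\vec q=(q_1,\dots,q_n)$, $1<q_i<\infty$, let $\|f\|_{\vec q}=\Big(\int_{\mathbb R}\cdots\big(\int_{\mathbb R}|f(x_1,\dots,x_n)|^{q_1}dx_1\big)^{q_2/q_1}\cdots dx_n\Big)^{1/q_n}$ be the mixed Lebesgue norm, and let $B_r=\{x\in\mathbb R^n:|x|<r\}$ with $|\cdot|$ the Euclidean norm. The mixed $\lambda$-central Morrey space $\mathcal B^{\vec q,\lambda}(\mathbb R^n)$ and the mixed central bounded mean oscillation space $\mathrm{CMO}^{\vec q}(\mathbb R^n)$ consist of the Lebesgue measurable $f:\mathbb R^n\to\mathbb C$ for which, respectively, $$\|f\|_{\mathcal B^{\vec q,\lambda}}=\sup_{r>0}\frac{\|f\chi_{B_r}\|_{\vec q}}{|B_r|^{\lambda}\,\|\chi_{B_r}\|_{\vec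 q}}<\infty ,\qquad \|f\|_{\mathrm{CMO}^{\vec q}}=\sup_{r>0}\frac{\|(f-f_{B_r})\chi_{B_r}\|_{\vec q}}{\|\chi_{B_r}\|_{\vec q}}<\infty ,$$ where $f_{B_r}=\frac1{|B_r|}\int_{B_r}f$ (in the second case $f$ is integrable on every $B_r$). For $x\ne0$ let $$\mathcal Hf(x)=\frac1{|x|^n}\int_{|t|<|x|}f(t)\,dt,\qquad \mathcal H^*f(x)=\int_{|t|\ge|x|}\frac{f(t)}{|t|^n}\,dt,$$ and, for a Lebesgue measurable function $b:\mathbb R^n\to\mathbb C$, let $\mathcal H_bf=b\,\mathcal Hf-\mathcal H(fb)$ and $\mathcal H_b^*f=b\,\mathcal H^*f-\mathcal H^*(fb)$. Such a commutator is called bounded on $\mathcal B^{\vec q,\lambda}(\mathbb R^n)$ if for every $f\in\mathcal B^{\vec q,\lambda}(\mathbb R^n)$ the integrals defining it converge absolutely for all $x\neq0$, and it maps $\mathcal B^{\vec q,\lambda}(\mathbb R^n)$ into itself with norm at most $C\|f\|_{\mathcal B^{\vec q,\lambda}}$, where $C$ does not depend on $f$. Then the following statements are equivalent: (a) $b\in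 \mathrm{CMO}^{\vec p}(\mathbb R^n)\cap\mathrm{CMO}^{\vec p\,'}(\mathbb R^n)$; (b) $\mathcal H_b$ and $\mathcal H_b^*$ are bounded on both $\mathcal B^{\vec p,\lambda}(\mathbb R^n)$ and $\mathcal B^{\vec p\,',\lambda}(\mathbb R^n)$. -/

import Mathlib

open MeasureTheory Metric Set
open scoped ENNReal NNReal

noncomputable section

namespace MixedHardy

/-- `ℝⁿ` with the Euclidean norm and Lebesgue measure. -/
abbrev Rn (n : ℕ) : Type := EuclideanSpace ℝ (Fin n)

/-- The iterated norm of a nonnegative function of `n` real variables: take the `L^{p₁}` norm in the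
first variable, then the `L^{p₂}` norm of the result in the second variable, and so on. -/
def iterNorm : (n : ℕ) → (Fin n → ℝ) → ((Fin n → ℝ) → ℝ≥0∞) → ℝ≥0∞
  | 0, _, g => g Fin.elim0
  | n + 1, p, g =>
      iterNorm n (fun i => p i.succ)
        (fun y => (∫⁻ t : ℝ, g (Fin.cons t y) ^ p 0) ^ (1 / p 0))

/-- The mixed Lebesgue norm `‖f‖_{L^p}` on `ℝⁿ`, for finite exponents `p₁, …, pₙ`. -/
def mixedNorm {n : ℕ} (p : Fin n → ℝ) (f : Rn n → ℂ) : ℝ≥0∞ :=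
  iterNorm n p (fun v => ‖f (WithLp.toLp 2 v)‖ₑ)

/-- `‖χ_{B(0,r)}‖_{L^p}`. -/
def ballNorm {n : ℕ} (p : Fin n → ℝ) (r : ℝ) : ℝ≥0∞ :=
  mixedNorm p ((ball (0 : Rn n) r).indicator fun _ => (1 : ℂ))

/-- The norm of the mixed `lam`-central Morrey space. -/
def morreyNorm {n : ℕ} (p : Fin n → ℝ) (lam : ℝ) (f : Rn n → ℂ) : ℝ≥0∞ :=
  ⨆ (r : ℝ) (_ : 0 < r),
    mixedNorm p ((ball (0 : Rn n) r).indicator f) /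
      (volume (ball (0 : Rn n) r) ^ lam * ballNorm p r)

/-- Membership in the mixed `lam`-central Morrey space. -/
def MemMorrey {n : ℕ} (p : Fin n → ℝ) (lam : ℝ) (f : Rn n → ℂ) : Prop :=
  AEStronglyMeasurable f volume ∧ morreyNorm p lam f < ∞

/-- The seminorm of the mixed central bounded mean oscillation space. If `f` is not integrable on
some ball then the average there has the value `0` by convention and, for exponents at least `1`,
the seminorm is infinite. -/
def cmoNorm {n : ℕ} (p : Fin n → ℝ) (f : Rn n → ℂ) : ℝ≥0∞ :=
  ⨆ (r : ℝ) (_ : 0 < r),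
    mixedNorm p ((ball (0 : Rn n) r).indicator fun x => f x - ⨍ t in ball (0 : Rn n) r, f t) /
      ballNorm p r

/-- Membership in the mixed central bounded mean oscillation space. -/
def MemCMO {n : ℕ} (p : Fin n → ℝ) (f : Rn n → ℂ) : Prop :=
  AEStronglyMeasurable f volume ∧ cmoNorm p f < ∞

/-- The `n`-dimensional Hardy operator. -/
def hardy {n : ℕ} (f : Rn n → ℂ) (x : Rn n) : ℂ :=
  (‖x‖ ^ n)⁻¹ • ∫ t in {t : Rn n | ‖t‖ < ‖x‖}, f t

/-- The integral defining `hardy f x` converges absolutely for every `x ≠ 0`. -/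
def HardyDefined {n : ℕ} (f : Rn n → ℂ) : Prop :=
  ∀ x : Rn n, x ≠ 0 → IntegrableOn f {t : Rn n | ‖t‖ < ‖x‖} volume

/-- The dual Hardy operator. -/
def dualHardy {n : ℕ} (f : Rn n → ℂ) (x : Rn n) : ℂ :=
  ∫ t in {t : Rn n | ‖x‖ ≤ ‖t‖}, (‖t‖ ^ n)⁻¹ • f t

/-- The integral defining `dualHardy f x` converges absolutely for every `x ≠ 0`. -/
def DualHardyDefined {n : ℕ} (f : Rn n → ℂ) : Prop :=
  ∀ x : Rn n, x ≠ 0 →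
    IntegrableOn (fun t => (‖t‖ ^ n)⁻¹ • f t) {t : Rn n | ‖x‖ ≤ ‖t‖} volume

/-- The commutator `b T f - T (f b)` of an operator `T` with the symbol `b`. -/
def commutator {n : ℕ} (T : (Rn n → ℂ) → Rn n → ℂ) (b f : Rn n → ℂ) : Rn n → ℂ :=
  fun x => b x * T f x - T (fun t => f t * b t) x

/-- The commutator, with symbol `b`, of the operator `T` with domain `D` is a bounded operator on
the mixed `lam`-central Morrey space: on each `f` in the space it is defined (both `T f` and
`T (f b)` are), its value lies in the space, and its norm is at most `C` times the norm of `f`,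
with `C` independent of `f`. -/
def CommutatorBounded {n : ℕ} (T : (Rn n → ℂ) → Rn n → ℂ) (D : (Rn n → ℂ) → Prop)
    (b : Rn n → ℂ) (p : Fin n → ℝ) (lam : ℝ) : Prop :=
  ∃ C : ℝ≥0, ∀ f : Rn n → ℂ, MemMorrey p lam f →
    (D f ∧ D fun t => f t * b t) ∧
    MemMorrey p lam (commutator T b f) ∧
    morreyNorm p lam (commutator T b f) ≤ C * morreyNorm p lam f

/-- The vector of conjugate exponents `pᵢ' = pᵢ / (pᵢ - 1)`. -/
def conj {n : ℕ} (p : Fin n → ℝ) : Fin n → ℝ := fun i => Real.conjExponent (p i)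

end MixedHardy

end

/-! Write σ(p) = ∑ 1/pᵢ (`expSum`). Comparison with cubes shows that balls and dyadic shells of
radius r have mixed norm comparable to r^σ(p), and σ(p) + σ(p') = n. Up to constants, a Morrey bound
therefore says ‖f χ_{B_r}‖_p ≲ r^s with s = nλ + σ(p), and everything can be discretized over the
shells S_k = {2^k ≤ |x| < 2^(k+1)}. The CMO condition becomes `ShellOsc`: on S_k the symbol is
close, in normalized norm, to a constant m_k, and consecutive constants differ boundedly. Hence |m_j
- m_k| grows at most linearly in |j - k|, a loss that any geometric decay absorbs
(`exists_shellOsc_of_cmoNorm`, `cmoNorm_lt_top_of_shellOsc`).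

(a) ⇒ (b). Both commutators are dominated by one positive operator, `majorant`, with kernel (1 +
|b(x) - b(t)|) max(|x|,|t|)^(-n). Split b(x) - b(t) through m_k and m_j: Hölder in t uses the
p'-oscillation of b, the norm in x uses the p-oscillation. The outcome on S_k is a discrete
convolution of the norms on the S_j with `shellKernel`, which decays in both directions because 0 <
σ(p) < n (`exists_majorant_shell_le`). If s > 0, growth of order r^s survives by summing geometric
series. If s < 0, the Morrey space contains only null functions. If s = 0, it is the mixed Lebesgue
space itself, and Young's inequality ℓ¹ * ℓ^r applies once the r-th power of the norm is additive
over shells, which is why the exponents are then required to coincide. For p the hypothesis on λ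
gives s > 0; for p' all three signs can occur.

(b) ⇒ (a). For f supported in S_k and x in S_{k+1}, |x|^n H_b f(x) = b(x)∫f - ∫fb
(`exists_shell_test`). Taking f = χ_{S_k} bounds the p-oscillation of b on S_{k+1} about its mean
m_k over S_k. Taking f extremal for mixed-norm duality, times the phase of b - m_k, bounds the
p'-norm of b - m_k on S_k, because ∫f(b - m_k) = (b(x) - m_k)∫f - |x|^n H_b f(x). So the Hardy
commutator on the p-space already yields both CMO conditions. -/

noncomputable section

namespace MixedHardy

/-! ### One-variable layers of the iterated norm -/

section Layer

variable {n : ℕ}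

/-- The `L^p` norm in the first variable. -/
def layerNorm (p : ℝ) (g : (Fin (n + 1) → ℝ) → ℝ≥0∞) (y : Fin n → ℝ) : ℝ≥0∞ :=
  (∫⁻ t : ℝ, g (Fin.cons t y) ^ p) ^ (1 / p)

theorem iterNorm_succ (p : Fin (n + 1) → ℝ) (g : (Fin (n + 1) → ℝ) → ℝ≥0∞) :
    iterNorm (n + 1) p g = iterNorm n (fun i => p i.succ) (layerNorm (p 0) g) := rfl

theorem measurable_cons :
    Measurable fun z : (Fin n → ℝ) × ℝ => (Fin.cons z.2 z.1 : Fin (n + 1) → ℝ) := by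
  refine measurable_pi_iff.2 fun i => ?_
  refine Fin.cases ?_ (fun j => ?_) i
  · simpa using measurable_snd
  · simpa [Function.comp_def] using (measurable_pi_apply j).comp measurable_fst

theorem measurable_cons_left (y : Fin n → ℝ) :
    Measurable fun t : ℝ => (Fin.cons t y : Fin (n + 1) → ℝ) :=
  measurable_cons.comp measurable_prodMk_left

theorem measurePreserving_cons :
    MeasurePreserving (fun z : (Fin n → ℝ) × ℝ => (Fin.cons z.2 z.1 : Fin (n + 1) → ℝ)) := by
  have h1 := (volume_preserving_piFinSuccAbove (fun _ : Fin (n + 1) => ℝ) 0).symm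
  have h2 : MeasurePreserving (Prod.swap : (Fin n → ℝ) × ℝ → ℝ × (Fin n → ℝ)) :=
    Measure.measurePreserving_swap
  have h3 := h1.comp h2
  convert h3 using 1
  ext z i
  refine Fin.cases ?_ (fun j => ?_) i
  · simp [MeasurableEquiv.piFinSuccAbove]
  · simp [MeasurableEquiv.piFinSuccAbove]

theorem ae_cons {P : (Fin (n + 1) → ℝ) → Prop} (h : ∀ᵐ v, P v) :
    ∀ᵐ y : Fin n → ℝ, ∀ᵐ t : ℝ, P (Fin.cons t y) :=
  Measure.ae_ae_of_ae_prod (measurePreserving_cons.quasiMeasurePreserving.ae h)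

theorem lintegral_cons {g : (Fin (n + 1) → ℝ) → ℝ≥0∞} (hg : Measurable g) :
    ∫⁻ v, g v = ∫⁻ y : Fin n → ℝ, ∫⁻ t : ℝ, g (Fin.cons t y) := by
  rw [← measurePreserving_cons.lintegral_comp hg]
  exact lintegral_prod _ (hg.comp measurable_cons).aemeasurable

theorem measurable_layerNorm {p : ℝ} {g : (Fin (n + 1) → ℝ) → ℝ≥0∞} (hg : Measurable g) :
    Measurable (layerNorm p g) := by
  have : Measurable fun z : (Fin n → ℝ) × ℝ => g (Fin.cons z.2 z.1) ^ p :=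
    (hg.comp measurable_cons).pow_const p
  exact (this.lintegral_prod_right').pow_const _

theorem layerNorm_mono_ae {p : ℝ} (hp : 0 < p) {g h : (Fin (n + 1) → ℝ) → ℝ≥0∞}
    (hgh : ∀ᵐ v, g v ≤ h v) : ∀ᵐ y, layerNorm p g y ≤ layerNorm p h y := by
  filter_upwards [ae_cons hgh] with y hy
  refine ENNReal.rpow_le_rpow (lintegral_mono_ae ?_) (by positivity)
  filter_upwards [hy] with t ht
  exact ENNReal.rpow_le_rpow ht hp.le

theorem layerNorm_add_le {p : ℝ} (hp : 1 ≤ p) {g h : (Fin (n + 1) → ℝ) → ℝ≥0∞}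
    (hg : Measurable g) (hh : Measurable h) (y : Fin n → ℝ) :
    layerNorm p (fun v => g v + h v) y ≤ layerNorm p g y + layerNorm p h y :=
  ENNReal.lintegral_Lp_add_le (hg.comp (measurable_cons_left y)).aemeasurable
    (hh.comp (measurable_cons_left y)).aemeasurable hp

theorem rpow_one_div_rpow {p : ℝ} (hp : 0 < p) (x : ℝ≥0∞) : (x ^ p) ^ (1 / p) = x := by
  rw [← ENNReal.rpow_mul, mul_one_div_cancel hp.ne', ENNReal.rpow_one]

theorem layerNorm_const_mul {p : ℝ} (hp : 0 < p) (c : ℝ≥0∞) {g : (Fin (n + 1) → ℝ) → ℝ≥0∞}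
    (hg : Measurable g) (y : Fin n → ℝ) :
    layerNorm p (fun v => c * g v) y = c * layerNorm p g y := by
  unfold layerNorm
  have h : Measurable fun t : ℝ => g (Fin.cons t y) ^ p :=
    (hg.comp (measurable_cons_left y)).pow_const p
  simp_rw [ENNReal.mul_rpow_of_nonneg _ _ hp.le]
  rw [lintegral_const_mul _ h, ENNReal.mul_rpow_of_nonneg _ _ (by positivity),
    rpow_one_div_rpow hp]

theorem iSup_rpow {ι : Sort*} {p : ℝ} (hp : 0 < p) (f : ι → ℝ≥0∞) :
    (⨆ i, f i) ^ p = ⨆ i, f i ^ p :=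
  (ENNReal.orderIsoRpow p hp).map_iSup f

theorem layerNorm_iSup {p : ℝ} (hp : 0 < p) {g : ℕ → (Fin (n + 1) → ℝ) → ℝ≥0∞}
    (hg : ∀ k, Measurable (g k)) (hm : Monotone g) (y : Fin n → ℝ) :
    layerNorm p (fun v => ⨆ k, g k v) y = ⨆ k, layerNorm p (g k) y := by
  unfold layerNorm
  simp_rw [iSup_rpow hp]
  rw [lintegral_iSup (f := fun k t => g k (Fin.cons t y) ^ p)
    (fun k => ((hg k).comp (measurable_cons_left y)).pow_const p)
    (fun i j hij t => ENNReal.rpow_le_rpow (hm hij _) hp.le), iSup_rpow (by positivity)]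

end Layer

/-! ### Iterated norms: Minkowski, monotone convergence, Hölder, duality -/

theorem iterNorm_mono_ae : ∀ {n : ℕ} {p : Fin n → ℝ} (_ : ∀ i, 0 < p i)
    {g h : (Fin n → ℝ) → ℝ≥0∞} (_ : ∀ᵐ v, g v ≤ h v), iterNorm n p g ≤ iterNorm n p h
  | 0, p, _, g, h, hgh => by
    -- With no variables left, Lebesgue measure is the Dirac mass at the only point, so an a.e.
    -- inequality holds there.
    have : ∀ᵐ v : Fin 0 → ℝ ∂(Measure.dirac Fin.elim0), g v ≤ h v := by
      have h0 : (volume : Measure (Fin 0 → ℝ)) = Measure.dirac Fin.elim0 := by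
        rw [volume_pi, Measure.pi_of_empty _ Fin.elim0]
      rwa [← h0]
    rw [ae_dirac_eq] at this
    exact this
  | n + 1, p, hp, g, h, hgh =>
    iterNorm_mono_ae (fun i => hp i.succ) (layerNorm_mono_ae (hp 0) hgh)

theorem iterNorm_mono {n : ℕ} {p : Fin n → ℝ} (hp : ∀ i, 0 < p i)
    {g h : (Fin n → ℝ) → ℝ≥0∞} (hgh : ∀ v, g v ≤ h v) : iterNorm n p g ≤ iterNorm n p h :=
  iterNorm_mono_ae hp (.of_forall hgh)

theorem iterNorm_add_le : ∀ {n : ℕ} {p : Fin n → ℝ} (_ : ∀ i, 1 ≤ p i)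
    {g h : (Fin n → ℝ) → ℝ≥0∞} (_ : Measurable g) (_ : Measurable h),
    iterNorm n p (fun v => g v + h v) ≤ iterNorm n p g + iterNorm n p h
  | 0, _, _, _, _, _, _ => le_rfl
  | _ + 1, _, hp, _, _, hg, hh =>
    (iterNorm_mono (fun i => zero_lt_one.trans_le (hp i.succ))
      (layerNorm_add_le (hp 0) hg hh)).trans
      (iterNorm_add_le (fun i => hp i.succ) (measurable_layerNorm hg) (measurable_layerNorm hh))

theorem iterNorm_const_mul : ∀ {n : ℕ} {p : Fin n → ℝ} (_ : ∀ i, 0 < p i) (c : ℝ≥0∞)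
    {g : (Fin n → ℝ) → ℝ≥0∞} (_ : Measurable g),
    iterNorm n p (fun v => c * g v) = c * iterNorm n p g
  | 0, _, _, _, _, _ => rfl
  | n + 1, p, hp, c, g, hg => by
    rw [iterNorm_succ, iterNorm_succ,
      ← iterNorm_const_mul (fun i => hp i.succ) c (measurable_layerNorm hg)]
    congr 1
    exact funext (layerNorm_const_mul (hp 0) c hg)

theorem iterNorm_iSup : ∀ {n : ℕ} {p : Fin n → ℝ} (_ : ∀ i, 0 < p i)
    {g : ℕ → (Fin n → ℝ) → ℝ≥0∞} (_ : ∀ k, Measurable (g k)) (_ : Monotone g),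
    iterNorm n p (fun v => ⨆ k, g k v) = ⨆ k, iterNorm n p (g k)
  | 0, _, _, _, _, _ => rfl
  | n + 1, p, hp, g, hg, hm => by
    simp_rw [iterNorm_succ]
    rw [← iterNorm_iSup (fun i => hp i.succ) (fun k => measurable_layerNorm (hg k))]
    · congr 1
      exact funext (layerNorm_iSup (hp 0) hg hm)
    · intro i j hij y
      refine ENNReal.rpow_le_rpow (lintegral_mono fun t => ?_) (one_div_pos.2 (hp 0)).le
      exact ENNReal.rpow_le_rpow (hm hij _) (hp 0).le

/-- Tonelli isolates the first variable; Hölder there leaves the product of the two layer norms, to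
which induction applies. -/
theorem lintegral_mul_le_iterNorm : ∀ {n : ℕ} {p q : Fin n → ℝ}
    (_ : ∀ i, (p i).HolderConjugate (q i))
    {g h : (Fin n → ℝ) → ℝ≥0∞} (_ : Measurable g) (_ : Measurable h),
    ∫⁻ v, g v * h v ≤ iterNorm n p g * iterNorm n q h
  | 0, p, q, _, g, h, hg, hh => by
    rw [volume_pi, Measure.pi_of_empty _ Fin.elim0, lintegral_dirac]
    rfl
  | n + 1, p, q, hpq, g, h, hg, hh => by
    rw [lintegral_cons (g := fun v => g v * h v) (hg.mul hh), iterNorm_succ, iterNorm_succ]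
    refine le_trans (lintegral_mono fun y => ?_) (lintegral_mul_le_iterNorm
      (fun i => hpq i.succ) (measurable_layerNorm hg) (measurable_layerNorm hh))
    exact ENNReal.lintegral_mul_le_Lp_mul_Lq volume (hpq 0)
      (hg.comp (measurable_cons_left y)).aemeasurable
      (hh.comp (measurable_cons_left y)).aemeasurable

theorem iterNorm_const_exponent : ∀ {n : ℕ} {q : ℝ} (_ : 0 < q)
    {g : (Fin n → ℝ) → ℝ≥0∞} (_ : Measurable g),
    iterNorm n (fun _ => q) g = (∫⁻ v, g v ^ q) ^ (1 / q)
  | 0, q, hq, g, hg => by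
    rw [volume_pi, Measure.pi_of_empty _ Fin.elim0, lintegral_dirac, rpow_one_div_rpow hq]
    rfl
  | n + 1, q, hq, g, hg => by
    rw [iterNorm_succ, iterNorm_const_exponent hq (measurable_layerNorm hg),
      lintegral_cons (hg.pow_const q)]
    simp_rw [layerNorm, ← ENNReal.rpow_mul, one_div_mul_cancel hq.ne', ENNReal.rpow_one]

theorem iterNorm_box : ∀ {n : ℕ} {p : Fin n → ℝ} (_ : ∀ i, 0 < p i) {I : Set ℝ}
    (_ : MeasurableSet I),
    iterNorm n p (fun v => ∏ i, I.indicator 1 (v i)) = ∏ i, volume I ^ (1 / p i)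
  | 0, _, _, _, _ => by simp [iterNorm]
  | n + 1, p, hp, I, hI => by
    have hm : Measurable fun v : Fin n → ℝ => ∏ i, I.indicator (1 : ℝ → ℝ≥0∞) (v i) :=
      Finset.measurable_prod _ fun i _ => (measurable_one.indicator hI).comp (measurable_pi_apply i)
    rw [iterNorm_succ, Fin.prod_univ_succ, ← iterNorm_box (fun i => hp i.succ) hI,
      ← iterNorm_const_mul (fun i => hp i.succ) _ hm]
    congr 1
    ext y
    simp only [layerNorm, Fin.prod_univ_succ, Fin.cons_zero, Fin.cons_succ]
    simp_rw [ENNReal.mul_rpow_of_nonneg _ _ (hp 0).le]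
    rw [lintegral_mul_const]
    · rw [ENNReal.mul_rpow_of_nonneg _ _ (one_div_pos.2 (hp 0)).le, rpow_one_div_rpow (hp 0)]
      congr 2
      rw [← lintegral_indicator_one hI]
      congr 1
      ext t
      by_cases ht : t ∈ I <;> simp [ht, hp 0]
    · exact (measurable_one.indicator hI).pow_const _

/-- Extremal functions for the duality of mixed norms. -/
theorem exists_iterNorm_dual : ∀ {n : ℕ} {p q : Fin n → ℝ}
    (_ : ∀ i, (p i).HolderConjugate (q i)) {M : ℝ≥0∞} (_ : M ≠ ∞) (R : ℝ)
    {g : (Fin n → ℝ) → ℝ≥0∞} (_ : Measurable g) (_ : ∀ v, g v ≤ M)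
    (_ : ∀ v i, R < |v i| → g v = 0),
    ∃ f : (Fin n → ℝ) → ℝ≥0∞, Measurable f ∧ (∀ v, g v = 0 → f v = 0) ∧
      iterNorm n p f ≤ 1 ∧ ∫⁻ v, f v * g v = iterNorm n q g
  | 0, p, q, _, M, _, R, g, hg, _, _ => by
    by_cases h0 : g Fin.elim0 = 0
    · refine ⟨fun _ => 0, measurable_const, fun _ _ => rfl, by simp [iterNorm], ?_⟩
      simp [iterNorm, h0]
    · refine ⟨fun _ => 1, measurable_const, fun v hv => ?_, by simp [iterNorm], ?_⟩
      · exact absurd (by rwa [Subsingleton.elim v Fin.elim0] at hv) h0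
      · rw [volume_pi, Measure.pi_of_empty _ Fin.elim0, lintegral_dirac]
        simp [iterNorm]
  | n + 1, p, q, hpq, M, hM, R, g, hg, hgM, hgR => by
    have hq0 : 0 < q 0 := (hpq 0).symm.pos
    have hp0 : 0 < p 0 := (hpq 0).pos
    have hq1 : 0 < q 0 - 1 := sub_pos.2 (hpq 0).symm.lt
    set N := layerNorm (q 0) g with hN
    have hNm : Measurable N := measurable_layerNorm hg
    -- The bound M and the support in [-R, R] give the layer norm `N` the same kind of hypotheses,
    -- with this new bound. In particular `N` is finite everywhere, so it can be cancelled at the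
    -- end.
    have hMR : (M ^ q 0 * volume (Icc (-R) R)) ^ (1 / q 0) ≠ ∞ := by
      refine ENNReal.rpow_ne_top_of_nonneg (by positivity) (ENNReal.mul_ne_top ?_ ?_)
      · exact ENNReal.rpow_ne_top_of_nonneg hq0.le hM
      · simp
    have hNM : ∀ y, N y ≤ (M ^ q 0 * volume (Icc (-R) R)) ^ (1 / q 0) := by
      intro y
      refine ENNReal.rpow_le_rpow ?_ (by positivity)
      rw [← lintegral_indicator_const measurableSet_Icc]
      refine lintegral_mono fun t => ?_
      by_cases ht : t ∈ Icc (-R) R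
      · simpa [ht] using ENNReal.rpow_le_rpow (hgM _) hq0.le
      · have : R < |t| := by
          rw [mem_Icc, ← abs_le] at ht
          exact not_le.1 ht
        simp [hgR (Fin.cons t y) 0 (by simpa using this), hq0]
    have hNR : ∀ y i, R < |y i| → N y = 0 := by
      intro y i hi
      have : ∀ t, g (Fin.cons t y) = 0 := fun t => hgR _ i.succ (by simpa using hi)
      simp [hN, layerNorm, this, hq0]
    have hNt : ∀ y, N y ≠ ∞ := fun y => ne_top_of_le_ne_top hMR (hNM y)
    obtain ⟨f, hf, hf0, hf1, hfe⟩ :=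
      exists_iterNorm_dual (fun i => hpq i.succ) hMR R hNm hNM hNR
    have htail : Measurable fun v : Fin (n + 1) → ℝ => Fin.tail v :=
      measurable_pi_iff.2 fun i => measurable_pi_apply i.succ
    have hcm : ∀ y, Measurable fun t : ℝ => g (Fin.cons t y) := fun y =>
      hg.comp (measurable_cons_left y)
    have hint : ∀ y, ∫⁻ t : ℝ, g (Fin.cons t y) ^ q 0 = N y ^ q 0 := by
      intro y
      rw [hN, layerNorm, ← ENNReal.rpow_mul, one_div_mul_cancel hq0.ne', ENNReal.rpow_one]
    -- Extremal function for the remaining variables applied to `N`, times the one-variable extremal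
    -- (g/N)^(q-1) on each line. Its layer in the first variable has norm at most 1 because (q-1)p =
    -- q.
    refine ⟨fun v => f (Fin.tail v) * (g v / N (Fin.tail v)) ^ (q 0 - 1), ?_, ?_, ?_, ?_⟩
    · exact (hf.comp htail).mul ((hg.div (hNm.comp htail)).pow_const _)
    · intro v hv
      simp [hv, hq1]
    · refine le_trans (iterNorm_mono (fun i => (hpq i.succ).pos) fun y => ?_) hf1
      simp only [Fin.tail_cons]
      simp_rw [ENNReal.mul_rpow_of_nonneg _ _ hp0.le, ← ENNReal.rpow_mul]
      have he : (q 0 - 1) * p 0 = q 0 := by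
        have := (hpq 0).symm.sub_one_mul_conj
        simpa using this
      rw [he, lintegral_const_mul _ (((hcm y).div_const _).pow_const _),
        ENNReal.mul_rpow_of_nonneg _ _ (by positivity), rpow_one_div_rpow hp0]
      refine mul_le_of_le_one_right' (ENNReal.rpow_le_one ?_ (by positivity))
      simp_rw [div_eq_mul_inv, ENNReal.mul_rpow_of_nonneg _ _ hq0.le]
      rw [lintegral_mul_const _ ((hcm y).pow_const _), hint,
        ← ENNReal.mul_rpow_of_nonneg _ _ hq0.le]
      exact ENNReal.rpow_le_one (ENNReal.mul_inv_le_one _) hq0.le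
    · rw [iterNorm_succ, ← hfe, lintegral_cons
        (g := fun v => f (Fin.tail v) * (g v / N (Fin.tail v)) ^ (q 0 - 1) * g v)
        (((hf.comp htail).mul ((hg.div (hNm.comp htail)).pow_const _)).mul hg)]
      refine lintegral_congr fun y => ?_
      simp only [Fin.tail_cons]
      simp_rw [mul_assoc]
      rw [lintegral_const_mul (f := fun t => (g (Fin.cons t y) / N y) ^ (q 0 - 1) * g (Fin.cons t y))
        _ ((((hcm y).div_const _).pow_const _).mul (hcm y))]
      congr 1
      have e1 : ∀ t : ℝ, (g (Fin.cons t y) / N y) ^ (q 0 - 1) * g (Fin.cons t y) =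
          (N y)⁻¹ ^ (q 0 - 1) * g (Fin.cons t y) ^ q 0 := by
        intro t
        rw [div_eq_mul_inv, ENNReal.mul_rpow_of_nonneg _ _ hq1.le]
        have : g (Fin.cons t y) ^ q 0 = g (Fin.cons t y) ^ (q 0 - 1) * g (Fin.cons t y) := by
          conv_lhs => rw [show q 0 = (q 0 - 1) + 1 by ring]
          rw [ENNReal.rpow_add_of_nonneg _ _ hq1.le zero_le_one, ENNReal.rpow_one]
        rw [this]
        ring
      simp_rw [e1]
      rw [lintegral_const_mul _ ((hcm y).pow_const _), hint]
      -- Where `N y = 0` the factor with `(N y)⁻¹` is infinite, but it multiplies `N y ^ q 0 = 0`,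
      -- and ∞ · 0 = 0.
      by_cases h0 : N y = 0
      · simp [h0, hq0]
      · have : N y ^ q 0 = N y ^ (q 0 - 1) * N y := by
          conv_lhs => rw [show q 0 = (q 0 - 1) + 1 by ring]
          rw [ENNReal.rpow_add_of_nonneg _ _ hq1.le zero_le_one, ENNReal.rpow_one]
        rw [this, ← mul_assoc, ← ENNReal.mul_rpow_of_nonneg _ _ hq1.le,
          ENNReal.inv_mul_cancel h0 (hNt y), ENNReal.one_rpow, one_mul]

/-! ### Transfer to Euclidean space -/

section MixedENorm

variable {n : ℕ} {p q : Fin n → ℝ}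

/-- The mixed Lebesgue norm of a nonnegative function. -/
def mixedENorm (p : Fin n → ℝ) (g : Rn n → ℝ≥0∞) : ℝ≥0∞ :=
  iterNorm n p fun v => g (WithLp.toLp 2 v)

theorem mixedNorm_eq (p : Fin n → ℝ) (f : Rn n → ℂ) :
    mixedNorm p f = mixedENorm p fun x => ‖f x‖ₑ := rfl

theorem mixedNorm_indicator (p : Fin n → ℝ) (s : Set (Rn n)) (f : Rn n → ℂ) :
    mixedNorm p (s.indicator f) = mixedENorm p (s.indicator fun x => ‖f x‖ₑ) := by
  simp_rw [mixedNorm_eq, enorm_indicator_eq_indicator_enorm]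

theorem measurable_toLp_two : Measurable fun v : Fin n → ℝ => (WithLp.toLp 2 v : Rn n) :=
  (PiLp.volume_preserving_toLp (Fin n)).measurable

theorem mixedENorm_mono_ae (hp : ∀ i, 0 < p i) {g h : Rn n → ℝ≥0∞} (hgh : g ≤ᵐ[volume] h) :
    mixedENorm p g ≤ mixedENorm p h :=
  iterNorm_mono_ae hp ((PiLp.volume_preserving_toLp (Fin n)).quasiMeasurePreserving.ae hgh)

theorem mixedENorm_mono (hp : ∀ i, 0 < p i) {g h : Rn n → ℝ≥0∞} (hgh : ∀ x, g x ≤ h x) :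
    mixedENorm p g ≤ mixedENorm p h :=
  mixedENorm_mono_ae hp (.of_forall hgh)

theorem mixedENorm_congr_ae (hp : ∀ i, 0 < p i) {g h : Rn n → ℝ≥0∞} (hgh : g =ᵐ[volume] h) :
    mixedENorm p g = mixedENorm p h :=
  (mixedENorm_mono_ae hp hgh.le).antisymm (mixedENorm_mono_ae hp hgh.symm.le)

theorem mixedENorm_add_le (hp : ∀ i, 1 < p i) {g h : Rn n → ℝ≥0∞} (hg : AEMeasurable g)
    (hh : AEMeasurable h) :
    mixedENorm p (fun x => g x + h x) ≤ mixedENorm p g + mixedENorm p h := by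
  have hp0 : ∀ i, 0 < p i := fun i => zero_lt_one.trans (hp i)
  rw [mixedENorm_congr_ae hp0 hg.ae_eq_mk, mixedENorm_congr_ae hp0 hh.ae_eq_mk,
    mixedENorm_congr_ae (g := fun x => g x + h x) hp0 (hg.ae_eq_mk.add hh.ae_eq_mk)]
  exact iterNorm_add_le (fun i => (hp i).le) (hg.measurable_mk.comp measurable_toLp_two)
    (hh.measurable_mk.comp measurable_toLp_two)

theorem mixedENorm_const_mul (hp : ∀ i, 0 < p i) (c : ℝ≥0∞) {g : Rn n → ℝ≥0∞}
    (hg : AEMeasurable g) : mixedENorm p (fun x => c * g x) = c * mixedENorm p g := by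
  have h : (fun x => c * g x) =ᵐ[volume] fun x => c * hg.mk g x := by
    filter_upwards [hg.ae_eq_mk] with x hx using by rw [hx]
  rw [mixedENorm_congr_ae hp hg.ae_eq_mk, mixedENorm_congr_ae hp h]
  exact iterNorm_const_mul hp c (hg.measurable_mk.comp measurable_toLp_two)

theorem mixedENorm_zero (hp : ∀ i, 0 < p i) : mixedENorm p (fun _ => 0) = 0 := by
  simpa using mixedENorm_const_mul hp 0 (g := fun _ => 0) aemeasurable_const

theorem mixedENorm_iSup (hp : ∀ i, 0 < p i) {g : ℕ → Rn n → ℝ≥0∞} (hg : ∀ k, Measurable (g k))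
    (hm : Monotone g) : mixedENorm p (fun x => ⨆ k, g k x) = ⨆ k, mixedENorm p (g k) :=
  iterNorm_iSup hp (fun k => (hg k).comp measurable_toLp_two) fun _ _ hij _ => hm hij _

theorem mixedENorm_sum_le (hp : ∀ i, 1 < p i) {ι : Type*} (s : Finset ι)
    {g : ι → Rn n → ℝ≥0∞} (hg : ∀ k, Measurable (g k)) :
    mixedENorm p (fun x => ∑ k ∈ s, g k x) ≤ ∑ k ∈ s, mixedENorm p (g k) := by
  classical
  induction s using Finset.induction with
  | empty => simp [mixedENorm_zero fun i => zero_lt_one.trans (hp i)]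
  | insert a s ha ih =>
    simp_rw [Finset.sum_insert ha]
    exact (mixedENorm_add_le hp (hg a).aemeasurable
      (Finset.measurable_fun_sum s fun k _ => hg k).aemeasurable).trans (by gcongr)

theorem mixedENorm_tsum_nat_le (hp : ∀ i, 1 < p i) {g : ℕ → Rn n → ℝ≥0∞}
    (hg : ∀ k, Measurable (g k)) :
    mixedENorm p (fun x => ∑' k, g k x) ≤ ∑' k, mixedENorm p (g k) := by
  simp_rw [ENNReal.tsum_eq_iSup_nat]
  rw [mixedENorm_iSup (fun i => zero_lt_one.trans (hp i))
    (fun k => Finset.measurable_fun_sum _ fun k _ => hg k)]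
  · exact iSup_mono fun k => mixedENorm_sum_le hp _ hg
  · intro i j hij x
    exact Finset.sum_le_sum_of_subset (Finset.range_mono hij)

theorem mixedENorm_tsum_le (hp : ∀ i, 1 < p i) {g : ℤ → Rn n → ℝ≥0∞}
    (hg : ∀ k, Measurable (g k)) :
    mixedENorm p (fun x => ∑' k, g k x) ≤ ∑' k, mixedENorm p (g k) := by
  rw [← Equiv.intEquivNat.symm.tsum_eq]
  simp_rw [← Equiv.intEquivNat.symm.tsum_eq fun k => g k _]
  exact mixedENorm_tsum_nat_le hp fun k => hg _

theorem lintegral_mul_le_mixedENorm (hpq : ∀ i, (p i).HolderConjugate (q i))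
    {g h : Rn n → ℝ≥0∞} (hg : AEMeasurable g) (hh : AEMeasurable h) :
    ∫⁻ x, g x * h x ≤ mixedENorm p g * mixedENorm q h := by
  have hp0 : ∀ i, 0 < p i := fun i => (hpq i).pos
  have hq0 : ∀ i, 0 < q i := fun i => (hpq i).symm.pos
  rw [mixedENorm_congr_ae hp0 hg.ae_eq_mk, mixedENorm_congr_ae hq0 hh.ae_eq_mk,
    lintegral_congr_ae (f := fun x => g x * h x) (hg.ae_eq_mk.mul hh.ae_eq_mk),
    ← (PiLp.volume_preserving_toLp (Fin n)).lintegral_comp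
      (hg.measurable_mk.mul hh.measurable_mk)]
  exact lintegral_mul_le_iterNorm hpq (hg.measurable_mk.comp measurable_toLp_two)
    (hh.measurable_mk.comp measurable_toLp_two)

theorem mixedENorm_const_exponent {r : ℝ} (hr : 0 < r) {g : Rn n → ℝ≥0∞} (hg : Measurable g) :
    mixedENorm (fun _ => r) g = (∫⁻ x, g x ^ r) ^ (1 / r) := by
  rw [← (PiLp.volume_preserving_toLp (Fin n)).lintegral_comp (hg.pow_const r)]
  exact iterNorm_const_exponent hr (hg.comp measurable_toLp_two)

/-- The set integral version of Hölder's inequality. -/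
theorem setLIntegral_le_mixedENorm (hpq : ∀ i, (p i).HolderConjugate (q i)) {s : Set (Rn n)}
    (hs : MeasurableSet s) {g : Rn n → ℝ≥0∞} (hg : AEMeasurable g) :
    ∫⁻ x in s, g x ≤ mixedENorm p (s.indicator g) * mixedENorm q (s.indicator 1) := by
  refine le_trans (le_of_eq ?_) (lintegral_mul_le_mixedENorm hpq (hg.indicator hs)
    (measurable_one.indicator hs).aemeasurable)
  rw [← lintegral_indicator hs]
  congr 1
  ext x
  by_cases hx : x ∈ s <;> simp [hx]

/-- Truncate `G` at height `m`, pair it with an extremal function from `exists_iterNorm_dual`, and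
let `m → ∞` by monotone convergence. Only test functions vanishing wherever `G` does are needed, so
a `G` living on a shell is tested by functions on that shell. -/
theorem mixedENorm_le_of_dual (hpq : ∀ i, (p i).HolderConjugate (q i)) {G : Rn n → ℝ≥0∞}
    (hG : Measurable G) {R : ℝ} (hR : ∀ x, R < ‖x‖ → G x = 0) {K : ℝ≥0∞}
    (h : ∀ F : Rn n → ℝ≥0∞, Measurable F → (∀ x, G x = 0 → F x = 0) → mixedENorm p F ≤ 1 →
      ∫⁻ x, F x * G x ≤ K) : mixedENorm q G ≤ K := by
  have hG' : G = fun x => ⨆ m : ℕ, G x ⊓ (m : ℝ≥0∞) := by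
    ext x
    rw [← inf_iSup_eq, ENNReal.iSup_natCast, inf_top_eq]
  rw [hG', mixedENorm_iSup (fun i => (hpq i).symm.pos) (fun m => hG.min measurable_const)
    (fun i j hij x => inf_le_inf_left _ (by exact_mod_cast hij))]
  refine iSup_le fun m => ?_
  obtain ⟨f, hf, hf0, hf1, hfe⟩ := exists_iterNorm_dual hpq (M := m) (by simp) R
    (g := fun v => G (WithLp.toLp 2 v) ⊓ (m : ℝ≥0∞))
    ((hG.min measurable_const).comp measurable_toLp_two) (fun v => inf_le_right)
    (fun v i hi => by
      have h1 : G (WithLp.toLp 2 v) = 0 :=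
        hR _ (hi.trans_le (by
          simpa using PiLp.norm_apply_le (WithLp.toLp 2 v : Rn n) i))
      simp [h1])
  have hFm : Measurable fun x : Rn n => f (WithLp.ofLp x) :=
    hf.comp (PiLp.volume_preserving_ofLp (Fin n)).measurable
  have h1 := h (fun x => f (WithLp.ofLp x)) hFm
    (fun x hx => hf0 _ (by simp [hx])) (by simpa [mixedENorm] using hf1)
  refine le_trans (le_of_eq hfe.symm) (le_trans ?_ h1)
  rw [← (PiLp.volume_preserving_toLp (Fin n)).lintegral_comp
    (f := fun x : Rn n => f (WithLp.ofLp x) * G x) (hFm.mul hG)]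
  exact lintegral_mono fun v => mul_le_mul' le_rfl inf_le_left

end MixedENorm

/-! ### Mixed norms of balls and shells, by comparison with cubes -/

section Box

variable {n : ℕ} {p : Fin n → ℝ}

/-- The homogeneity degree of the mixed norm. -/
def expSum (p : Fin n → ℝ) : ℝ := ∑ i, 1 / p i

theorem prod_rpow_expSum {x : ℝ≥0∞} (hx0 : x ≠ 0) (hx : x ≠ ∞) :
    ∏ i, x ^ (1 / p i) = x ^ expSum p := by
  unfold expSum
  induction (Finset.univ : Finset (Fin n)) using Finset.induction with
  | empty => simp
  | insert a s ha ih =>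
    rw [Finset.prod_insert ha, Finset.sum_insert ha, ih, ENNReal.rpow_add _ _ hx0 hx]

theorem mixedENorm_box (hp : ∀ i, 0 < p i) {I : Set ℝ} (hI : MeasurableSet I)
    (h0 : volume I ≠ 0) (h1 : volume I ≠ ∞) :
    mixedENorm p ({x : Rn n | ∀ i, x i ∈ I}.indicator 1) = volume I ^ expSum p := by
  rw [← prod_rpow_expSum h0 h1, ← iterNorm_box hp hI]
  unfold mixedENorm
  congr 1
  ext v
  by_cases h : ∀ i, v i ∈ I
  · rw [indicator_of_mem (by simpa using h)]
    simp [h]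
  · rw [indicator_of_notMem (by simpa using h)]
    push Not at h
    obtain ⟨i, hi⟩ := h
    exact (Finset.prod_eq_zero (Finset.mem_univ i) (by simp [hi])).symm

/-- The spherical shell of inner radius `r` and outer radius `2r`. -/
def annulus (r : ℝ) : Set (Rn n) := {x | r ≤ ‖x‖ ∧ ‖x‖ < 2 * r}

/-- The cube [r/√n, 2r/√n)ⁿ lies in the shell, and the mixed norm of a cube of side ℓ is exactly
ℓ^`expSum p`. -/
theorem rpow_le_mixedENorm_annulus (hn : 1 ≤ n) (hp : ∀ i, 0 < p i) {r : ℝ} (hr : 0 < r) :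
    ENNReal.ofReal r ^ expSum p ≤
      ENNReal.ofReal √n ^ expSum p * mixedENorm p ((annulus r : Set (Rn n)).indicator 1) := by
  have hn0 : (0 : ℝ) < √n := Real.sqrt_pos.2 (by exact_mod_cast hn)
  have hs : 0 < r / √n := by positivity
  have hE : 0 ≤ expSum p := Finset.sum_nonneg fun i _ => (one_div_pos.2 (hp i)).le
  have hv : volume (Ico (r / √n) (2 * (r / √n))) = ENNReal.ofReal (r / √n) := by
    rw [Real.volume_Ico]; congr 1; ring
  have hbox := mixedENorm_box hp (measurableSet_Ico (a := r / √n) (b := 2 * (r / √n)))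
    (by rw [hv]; simpa using hs) (by rw [hv]; simp)
  rw [hv] at hbox
  have hle : mixedENorm p ({x : Rn n | ∀ i, x i ∈ Ico (r / √n) (2 * (r / √n))}.indicator 1) ≤
      mixedENorm p ((annulus r : Set (Rn n)).indicator 1) := by
    refine mixedENorm_mono hp fun x => indicator_le_indicator_of_subset ?_ (fun _ => zero_le) x
    intro x hx
    have hsum : ‖x‖ ^ 2 = ∑ i, x i ^ 2 := by
      rw [EuclideanSpace.norm_sq_eq]; simp
    have hsq : ∀ c : ℝ, n * (c / √n) ^ 2 = c ^ 2 := fun c => by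
      rw [div_pow, Real.sq_sqrt (by positivity)]
      field_simp
    have hne : (Finset.univ : Finset (Fin n)).Nonempty := ⟨⟨0, hn⟩, Finset.mem_univ _⟩
    constructor
    · have : r ^ 2 ≤ ‖x‖ ^ 2 := by
        rw [hsum, ← hsq r]
        calc (n : ℝ) * (r / √n) ^ 2 = ∑ i : Fin n, (r / √n) ^ 2 := by simp
          _ ≤ _ := Finset.sum_le_sum fun i _ => pow_le_pow_left₀ hs.le (hx i).1 2
      exact le_of_sq_le_sq this (norm_nonneg _)
    · have : ‖x‖ ^ 2 < (2 * r) ^ 2 := by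
        rw [hsum, ← hsq (2 * r)]
        calc _ < ∑ i : Fin n, (2 * r / √n) ^ 2 := by
              refine Finset.sum_lt_sum_of_nonempty hne fun i _ =>
                pow_lt_pow_left₀ ?_ (hs.le.trans (hx i).1) two_ne_zero
              rw [mul_div_assoc]
              exact (hx i).2
          _ = _ := by simp
      exact lt_of_pow_lt_pow_left₀ 2 (by positivity) this
  rw [hbox] at hle
  calc ENNReal.ofReal r ^ expSum p
      = ENNReal.ofReal √n ^ expSum p * ENNReal.ofReal (r / √n) ^ expSum p := by
        rw [← ENNReal.mul_rpow_of_nonneg _ _ hE, ← ENNReal.ofReal_mul hn0.le,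
          mul_div_cancel₀ _ hn0.ne']
    _ ≤ _ := by gcongr

theorem mixedENorm_ball_le (hp : ∀ i, 0 < p i) {r : ℝ} (hr : 0 < r) :
    mixedENorm p ((ball (0 : Rn n) r).indicator 1) ≤
      2 ^ expSum p * ENNReal.ofReal r ^ expSum p := by
  have hE : 0 ≤ expSum p := Finset.sum_nonneg fun i _ => (one_div_pos.2 (hp i)).le
  have hv : volume (Icc (-r) r) = 2 * ENNReal.ofReal r := by
    rw [Real.volume_Icc, show (2 : ℝ≥0∞) = ENNReal.ofReal 2 by simp,
      ← ENNReal.ofReal_mul zero_le_two]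
    congr 1; ring
  have hbox := mixedENorm_box hp (measurableSet_Icc (a := -r) (b := r))
    (by rw [hv]; simpa using hr) (by rw [hv]; exact ENNReal.mul_ne_top (by simp) (by simp))
  rw [← ENNReal.mul_rpow_of_nonneg _ _ hE, ← hv, ← hbox]
  refine mixedENorm_mono hp fun x => indicator_le_indicator_of_subset ?_ (fun _ => zero_le) x
  intro x hx i
  rw [mem_ball_zero_iff] at hx
  have := (PiLp.norm_apply_le x i).trans hx.le
  rwa [Real.norm_eq_abs, abs_le] at this

end Box

/-! ### Powers of two, weighted geometric sums, discrete convolution -/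

section Dyadic

/-- Powers of two in `ℝ≥0∞`. -/
def pow2 (s : ℝ) : ℝ≥0∞ := 2 ^ s

theorem pow2_ne_zero (s : ℝ) : pow2 s ≠ 0 := by simp [pow2]

theorem pow2_ne_top (s : ℝ) : pow2 s ≠ ∞ := by simp [pow2]

theorem pow2_add (s t : ℝ) : pow2 (s + t) = pow2 s * pow2 t :=
  ENNReal.rpow_add _ _ (by simp) (by simp)

theorem pow2_rpow (s t : ℝ) : pow2 s ^ t = pow2 (s * t) := (ENNReal.rpow_mul _ _ _).symm

theorem pow2_zero : pow2 0 = 1 := ENNReal.rpow_zero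

theorem pow2_mono {s t : ℝ} (h : s ≤ t) : pow2 s ≤ pow2 t :=
  ENNReal.rpow_le_rpow_of_exponent_le (by norm_num) h

theorem pow2_mul_pow2_neg (s : ℝ) : pow2 s * pow2 (-s) = 1 := by
  rw [← pow2_add, add_neg_cancel, pow2_zero]

theorem ofReal_two_rpow (s : ℝ) : ENNReal.ofReal (2 ^ s) = pow2 s := by
  rw [← ENNReal.ofReal_rpow_of_pos zero_lt_two]; simp [pow2]

theorem exists_dyadic {r : ℝ} (hr : 0 < r) :
    ∃ k : ℤ, (2 : ℝ) ^ (k : ℝ) ≤ r ∧ r < 2 * (2 : ℝ) ^ (k : ℝ) := by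
  obtain ⟨k, h1, h2⟩ := exists_mem_Ico_zpow hr one_lt_two
  refine ⟨k, by rwa [Real.rpow_intCast], ?_⟩
  rwa [Real.rpow_intCast, ← zpow_one_add₀ two_ne_zero, add_comm]

/-- The linear factor is the price of the drift of the constants in `ShellOsc`; geometric decay
absorbs it. -/
theorem tsum_weight_ne_top {δ : ℝ} (hδ : 0 < δ) :
    ∑' m : ℤ, (1 + (m.natAbs : ℝ≥0∞)) * pow2 (-(δ * m.natAbs)) ≠ ∞ := by
  have hterm : ∀ m : ℕ, (1 + (m : ℝ≥0∞)) * pow2 (-(δ * m)) =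
      ENNReal.ofReal ((1 + (m : ℝ)) * (2 ^ (-δ)) ^ m) := by
    intro m
    rw [ENNReal.ofReal_mul (by positivity), ← Real.rpow_mul_natCast zero_le_two, ofReal_two_rpow,
      ENNReal.ofReal_add zero_le_one (by positivity)]
    simp
  have hlt : ‖(2 : ℝ) ^ (-δ)‖ < 1 := by
    rw [Real.norm_of_nonneg (by positivity)]
    exact Real.rpow_lt_one_of_one_lt_of_neg one_lt_two (by linarith)
  have hs : Summable fun m : ℕ => (1 + (m : ℝ)) * (2 ^ (-δ)) ^ m := by
    simp_rw [add_mul, one_mul]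
    refine (summable_geometric_of_norm_lt_one hlt).add ?_
    simpa using summable_pow_mul_geometric_of_norm_lt_one 1 hlt
  have hz : Summable fun m : ℤ => (1 + (m.natAbs : ℝ)) * (2 ^ (-δ)) ^ m.natAbs :=
    .of_nat_of_neg (by simpa using hs) (by simpa using hs)
  simp_rw [hterm]
  exact hz.tsum_ofReal_ne_top

theorem tsum_sub_left (K : ℤ → ℝ≥0∞) (k : ℤ) : ∑' j, K (k - j) = ∑' m, K m :=
  (Equiv.subLeft k).tsum_eq K

theorem tsum_sub_right (K : ℤ → ℝ≥0∞) (j : ℤ) : ∑' k, K (k - j) = ∑' m, K m :=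
  (Equiv.subRight j).tsum_eq K

/-- Hölder for the splitting w = w^(1-1/q) · w^(1/q), first on finite sets. -/
theorem tsum_mul_rpow_le {q : ℝ} (hq : 1 ≤ q) {ι : Type*} (w f : ι → ℝ≥0∞) :
    (∑' i, w i * f i) ^ q ≤ (∑' i, w i) ^ (q - 1) * ∑' i, w i * f i ^ q := by
  have hq0 : 0 < q := by linarith
  have h1 : ∑' i, w i * f i ≤ (∑' i, w i) ^ (1 - q⁻¹) * (∑' i, w i * f i ^ q) ^ q⁻¹ := by
    rw [ENNReal.tsum_eq_iSup_sum]
    refine iSup_le fun s => (ENNReal.inner_le_weight_mul_Lp_of_nonneg s hq w f).trans ?_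
    have : 0 ≤ 1 - q⁻¹ := sub_nonneg.2 (inv_le_one_of_one_le₀ hq)
    exact mul_le_mul' (ENNReal.rpow_le_rpow (ENNReal.sum_le_tsum s) this)
      (ENNReal.rpow_le_rpow (ENNReal.sum_le_tsum s) (by positivity))
  refine (ENNReal.rpow_le_rpow h1 hq0.le).trans (le_of_eq ?_)
  rw [ENNReal.mul_rpow_of_nonneg _ _ hq0.le, ← ENNReal.rpow_mul, ← ENNReal.rpow_mul,
    inv_mul_cancel₀ hq0.ne', ENNReal.rpow_one, sub_mul, inv_mul_cancel₀ hq0.ne', one_mul]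

/-- Young's convolution inequality `ℓ¹ * ℓ^q ⊆ ℓ^q`. -/
theorem tsum_conv_rpow_le {q : ℝ} (hq : 1 ≤ q) (K F : ℤ → ℝ≥0∞) :
    ∑' k, (∑' j, K (k - j) * F j) ^ q ≤ (∑' m, K m) ^ q * ∑' j, F j ^ q := by
  calc ∑' k, (∑' j, K (k - j) * F j) ^ q
      ≤ ∑' k, (∑' m, K m) ^ (q - 1) * ∑' j, K (k - j) * F j ^ q := by
        refine ENNReal.tsum_le_tsum fun k => ?_
        rw [← tsum_sub_left K k]
        exact tsum_mul_rpow_le hq _ _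
    _ = (∑' m, K m) ^ q * ∑' j, F j ^ q := by
        rw [ENNReal.tsum_mul_left, ENNReal.tsum_comm]
        simp_rw [ENNReal.tsum_mul_right, tsum_sub_right K]
        rw [ENNReal.tsum_mul_left, ← mul_assoc]
        congr 1
        conv_rhs => rw [show q = (q - 1) + 1 by ring]
        rw [ENNReal.rpow_add_of_nonneg _ _ (by linarith) zero_le_one, ENNReal.rpow_one]

end Dyadic

/-! ### Dyadic shells -/

section Shell

variable {n : ℕ} {p : Fin n → ℝ}

/-- The dyadic shell `2 ^ k ≤ ‖x‖ < 2 ^ (k + 1)`. -/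
def shell (k : ℤ) : Set (Rn n) := annulus (2 ^ (k : ℝ))

theorem measurableSet_annulus (r : ℝ) : MeasurableSet (annulus r : Set (Rn n)) :=
  (measurableSet_le measurable_const measurable_norm).inter
    (measurableSet_lt measurable_norm measurable_const)

theorem measurableSet_shell (k : ℤ) : MeasurableSet (shell k : Set (Rn n)) :=
  measurableSet_annulus _

theorem exists_mem_shell {x : Rn n} (hx : x ≠ 0) : ∃ k : ℤ, x ∈ (shell k : Set (Rn n)) :=
  exists_dyadic (norm_pos_iff.2 hx)

theorem two_mul_two_rpow (k : ℤ) : 2 * (2 : ℝ) ^ (k : ℝ) = 2 ^ ((k : ℝ) + 1) := by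
  rw [Real.rpow_add_one two_ne_zero, mul_comm]

theorem shell_subset_ball (k : ℤ) : (shell k : Set (Rn n)) ⊆ ball 0 (2 ^ ((k : ℝ) + 1)) := by
  intro x hx
  rw [mem_ball_zero_iff, ← two_mul_two_rpow]
  exact hx.2

theorem pow2_le_enorm {k : ℤ} {x : Rn n} (hx : x ∈ (shell k : Set (Rn n))) :
    pow2 k ≤ ‖x‖ₑ := by
  rw [← ofReal_two_rpow, ← ofReal_norm]
  exact ENNReal.ofReal_le_ofReal hx.1

theorem enorm_le_pow2 {k : ℤ} {x : Rn n} (hx : x ∈ (shell k : Set (Rn n))) :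
    ‖x‖ₑ ≤ pow2 (k + 1) := by
  rw [← ofReal_two_rpow, ← ofReal_norm, ← two_mul_two_rpow]
  exact ENNReal.ofReal_le_ofReal hx.2.le

theorem eq_of_mem_shell {j k : ℤ} {x : Rn n} (hj : x ∈ (shell j : Set (Rn n)))
    (hk : x ∈ (shell k : Set (Rn n))) : j = k := by
  have key : ∀ {j k : ℤ}, x ∈ (shell j : Set (Rn n)) → x ∈ (shell k : Set (Rn n)) → j ≤ k := by
    intro j k hj hk
    have h := hj.1.trans_lt hk.2
    rw [two_mul_two_rpow, Real.rpow_lt_rpow_left_iff one_lt_two] at h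
    exact Int.lt_add_one_iff.1 (by exact_mod_cast h)
  exact (key hj hk).antisymm (key hk hj)

theorem ae_ne_zero (hn : 1 ≤ n) : ∀ᵐ x : Rn n, x ≠ 0 := by
  have : Nonempty (Fin n) := ⟨⟨0, hn⟩⟩
  exact compl_mem_ae_iff.2 (measure_singleton 0)

theorem tsum_indicator_shell (h : Rn n → ℝ≥0∞) {x : Rn n} (hx : x ≠ 0) :
    ∑' j : ℤ, (shell j : Set (Rn n)).indicator h x = h x := by
  obtain ⟨k, hk⟩ := exists_mem_shell hx
  rw [tsum_eq_single k, indicator_of_mem hk]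
  intro j hj
  exact indicator_of_notMem (fun hj' => hj (eq_of_mem_shell hj' hk)) _

theorem lintegral_eq_tsum_shell (hn : 1 ≤ n) {h : Rn n → ℝ≥0∞} (hh : Measurable h) :
    ∫⁻ x, h x = ∑' j : ℤ, ∫⁻ x in shell j, h x := by
  simp_rw [← lintegral_indicator (measurableSet_shell _)]
  rw [← lintegral_tsum fun j => (hh.indicator (measurableSet_shell j)).aemeasurable]
  refine lintegral_congr_ae ?_
  filter_upwards [ae_ne_zero hn] with x hx using (tsum_indicator_shell h hx).symm

/-- Off the origin the ball is covered by the shells meeting it, so countable Minkowski applies. -/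
theorem mixedENorm_ball_le_tsum (hn : 1 ≤ n) (hp : ∀ i, 1 < p i) {h : Rn n → ℝ≥0∞}
    (hh : Measurable h) (r : ℝ) :
    mixedENorm p ((ball (0 : Rn n) r).indicator h) ≤
      ∑' j : ℤ, if (2 : ℝ) ^ (j : ℝ) < r then
        mixedENorm p ((shell j : Set (Rn n)).indicator h) else 0 := by
  have hp0 : ∀ i, 0 < p i := fun i => zero_lt_one.trans (hp i)
  let g : ℤ → Rn n → ℝ≥0∞ := fun j =>
    if (2 : ℝ) ^ (j : ℝ) < r then (shell j : Set (Rn n)).indicator h else fun _ => 0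
  have hg : ∀ j, Measurable (g j) := fun j => by
    dsimp only [g]
    split_ifs
    · exact hh.indicator (measurableSet_shell j)
    · exact measurable_const
  have h1 : mixedENorm p ((ball (0 : Rn n) r).indicator h) ≤
      mixedENorm p fun x => ∑' j, g j x := by
    refine mixedENorm_mono_ae hp0 ?_
    filter_upwards [ae_ne_zero hn] with x hx
    by_cases hxr : x ∈ ball (0 : Rn n) r
    · obtain ⟨k, hk⟩ := exists_mem_shell hx
      refine le_trans (le_of_eq ?_) (ENNReal.le_tsum k)
      have : (2 : ℝ) ^ (k : ℝ) < r := hk.1.trans_lt (mem_ball_zero_iff.1 hxr)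
      dsimp only [g]
      rw [indicator_of_mem hxr, if_pos this, indicator_of_mem hk]
    · simp [hxr]
  refine h1.trans ((mixedENorm_tsum_le hp hg).trans (le_of_eq ?_))
  refine tsum_congr fun j => ?_
  dsimp only [g]
  split_ifs
  · rfl
  · exact mixedENorm_zero hp0

theorem expSum_nonneg (hp : ∀ i, 0 < p i) : 0 ≤ expSum p :=
  Finset.sum_nonneg fun i _ => (one_div_pos.2 (hp i)).le

theorem exists_pow2_le_mixedENorm_shell (hn : 1 ≤ n) (hp : ∀ i, 0 < p i) :
    ∃ c : ℝ≥0∞, c ≠ ∞ ∧ ∀ k : ℤ, pow2 (k * expSum p) ≤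
      c * mixedENorm p ((shell k : Set (Rn n)).indicator 1) := by
  refine ⟨ENNReal.ofReal √n ^ expSum p,
    ENNReal.rpow_ne_top_of_nonneg (expSum_nonneg hp) (by simp), fun k => ?_⟩
  rw [← pow2_rpow, ← ofReal_two_rpow]
  exact rpow_le_mixedENorm_annulus hn hp (by positivity)

theorem exists_mixedENorm_shell_le (hp : ∀ i, 0 < p i) :
    ∃ c : ℝ≥0∞, c ≠ ∞ ∧ ∀ k : ℤ, mixedENorm p ((shell k : Set (Rn n)).indicator 1) ≤
      c * pow2 (k * expSum p) := by
  have hE := expSum_nonneg hp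
  refine ⟨2 ^ expSum p * pow2 (expSum p), ENNReal.mul_ne_top
    (ENNReal.rpow_ne_top_of_nonneg hE (by simp)) (pow2_ne_top _), fun k => ?_⟩
  refine (mixedENorm_mono hp fun x => indicator_le_indicator_of_subset (shell_subset_ball k)
    (fun _ => zero_le) x).trans ((mixedENorm_ball_le hp (by positivity)).trans (le_of_eq ?_))
  rw [ofReal_two_rpow, pow2_rpow, mul_assoc, ← pow2_add]
  ring_nf

/-- With all exponents equal to 1 the mixed norm is the integral, so volume bounds follow from the
mixed-norm bounds. -/
theorem volume_shell_eq (k : ℤ) :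
    volume (shell k : Set (Rn n)) = mixedENorm (fun _ => 1) ((shell k : Set (Rn n)).indicator 1) := by
  rw [mixedENorm_const_exponent one_pos (measurable_one.indicator (measurableSet_shell k))]
  simp [lintegral_indicator_one (measurableSet_shell k)]

theorem expSum_one : expSum (fun _ : Fin n => (1 : ℝ)) = n := by simp [expSum]

theorem exists_pow2_le_volume_shell (hn : 1 ≤ n) :
    ∃ c : ℝ≥0∞, c ≠ ∞ ∧ ∀ k : ℤ, pow2 (k * n) ≤ c * volume (shell k : Set (Rn n)) := by
  simp_rw [volume_shell_eq]
  simpa [expSum_one] using exists_pow2_le_mixedENorm_shell (p := fun _ : Fin n => (1 : ℝ)) hn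
    fun _ => one_pos

theorem volume_shell_ne_top (k : ℤ) : volume (shell k : Set (Rn n)) ≠ ∞ :=
  ((measure_mono (shell_subset_ball k)).trans_lt measure_ball_lt_top).ne

theorem volume_shell_ne_zero (hn : 1 ≤ n) (k : ℤ) : volume (shell k : Set (Rn n)) ≠ 0 := by
  obtain ⟨c, -, h⟩ := exists_pow2_le_volume_shell hn
  intro h0
  have := h k
  simp [h0, pow2_ne_zero] at this

/-- This is why the normalizations in p and p' multiply to r^n, the order of the volume. -/
theorem expSum_add_conj {q : Fin n → ℝ} (hpq : ∀ i, (p i).HolderConjugate (q i)) :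
    expSum p + expSum q = n := by
  rw [expSum, expSum, ← Finset.sum_add_distrib]
  simp [(hpq _).inv_add_inv_eq_one]

theorem expSum_pos (hn : 1 ≤ n) (hp : ∀ i, 0 < p i) : 0 < expSum p :=
  Finset.sum_pos (fun i _ => one_div_pos.2 (hp i)) ⟨⟨0, hn⟩, Finset.mem_univ _⟩

/-- A function of finite mixed norm on a bounded set is finite almost everywhere there. -/
theorem ae_lt_top_of_mixedENorm_ball_ne_top {q : Fin n → ℝ}
    (hpq : ∀ i, (p i).HolderConjugate (q i)) {g : Rn n → ℝ≥0∞} (hg : Measurable g)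
    (h : ∀ r : ℝ, 0 < r → mixedENorm p ((ball (0 : Rn n) r).indicator g) ≠ ∞) :
    ∀ᵐ x, g x < ∞ := by
  have key : ∀ k : ℕ, ∀ᵐ x : Rn n, x ∈ ball (0 : Rn n) (k + 1) → g x < ∞ := by
    intro k
    have hk : (0 : ℝ) < k + 1 := by positivity
    refine (ae_restrict_iff' measurableSet_ball).1 (ae_lt_top hg ?_)
    refine ((setLIntegral_le_mixedENorm hpq measurableSet_ball hg.aemeasurable).trans_lt
      (ENNReal.mul_lt_top (h _ hk).lt_top ?_)).ne
    refine (mixedENorm_ball_le (fun i => (hpq i).symm.pos) hk).trans_lt ?_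
    have := expSum_nonneg fun i => (hpq i).symm.pos
    exact ENNReal.mul_lt_top (ENNReal.rpow_lt_top_of_nonneg this (by simp))
      (ENNReal.rpow_lt_top_of_nonneg this (by simp))
  filter_upwards [ae_all_iff.2 key] with x hx
  obtain ⟨k, hk⟩ := exists_nat_gt ‖x‖
  exact hx k (by rw [mem_ball_zero_iff]; linarith)

end Shell

/-! ### CMO and Morrey norms as power bounds on balls -/

section Interface

variable {n : ℕ} {p : Fin n → ℝ}

/-- This and `iSup_div_le_mul` are the two halves of one translation: a supremum of quotients with
denominator comparable to r^s is the best constant in F r ≲ r^s. -/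
theorem le_mul_iSup_div {F D : ℝ → ℝ≥0∞} {c : ℝ≥0∞} {s : ℝ}
    (h0 : ∀ r, 0 < r → D r ≠ 0) (ht : ∀ r, 0 < r → D r ≠ ∞)
    (hD : ∀ r, 0 < r → D r ≤ c * ENNReal.ofReal r ^ s) {r : ℝ} (hr : 0 < r) :
    F r ≤ c * ENNReal.ofReal r ^ s * ⨆ (r : ℝ) (_ : 0 < r), F r / D r := by
  have h1 : F r / D r ≤ ⨆ (r : ℝ) (_ : 0 < r), F r / D r := le_iSup₂ (f := fun r _ => F r / D r) r hr
  rw [ENNReal.div_le_iff (h0 r hr) (ht r hr), mul_comm] at h1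
  exact h1.trans (mul_le_mul' (hD r hr) le_rfl)

theorem iSup_div_le_mul {F D : ℝ → ℝ≥0∞} {c A : ℝ≥0∞} {s : ℝ}
    (hD : ∀ r, 0 < r → ENNReal.ofReal r ^ s ≤ c * D r)
    (hF : ∀ r, 0 < r → F r ≤ A * ENNReal.ofReal r ^ s) :
    ⨆ (r : ℝ) (_ : 0 < r), F r / D r ≤ c * A := by
  refine iSup₂_le fun r hr => ENNReal.div_le_of_le_mul ((hF r hr).trans ?_)
  calc A * ENNReal.ofReal r ^ s ≤ A * (c * D r) := by gcongr; exact hD r hr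
    _ = c * A * D r := by ring

theorem ballNorm_eq (r : ℝ) :
    ballNorm p r = mixedENorm p ((ball (0 : Rn n) r).indicator 1) := by
  rw [ballNorm, mixedNorm_indicator]
  simp only [enorm_one]
  rfl

theorem exists_ballNorm_le (hp : ∀ i, 0 < p i) :
    ∃ c : ℝ≥0∞, c ≠ ∞ ∧ ∀ r : ℝ, 0 < r → ballNorm p r ≤ c * ENNReal.ofReal r ^ expSum p := by
  refine ⟨2 ^ expSum p, ENNReal.rpow_ne_top_of_nonneg (expSum_nonneg hp) (by simp), fun r hr => ?_⟩
  rw [ballNorm_eq]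
  exact mixedENorm_ball_le hp hr

theorem exists_le_ballNorm (hn : 1 ≤ n) (hp : ∀ i, 0 < p i) :
    ∃ c : ℝ≥0∞, c ≠ ∞ ∧ ∀ r : ℝ, 0 < r → ENNReal.ofReal r ^ expSum p ≤ c * ballNorm p r := by
  have hE := expSum_nonneg hp
  refine ⟨2 ^ expSum p * ENNReal.ofReal √n ^ expSum p, ENNReal.mul_ne_top
    (ENNReal.rpow_ne_top_of_nonneg hE (by simp)) (ENNReal.rpow_ne_top_of_nonneg hE (by simp)),
    fun r hr => ?_⟩
  have h := rpow_le_mixedENorm_annulus hn hp (half_pos hr)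
  have h2 : mixedENorm p ((annulus (r / 2) : Set (Rn n)).indicator 1) ≤ ballNorm p r := by
    rw [ballNorm_eq]
    refine mixedENorm_mono hp fun x => indicator_le_indicator_of_subset (fun y hy => ?_)
      (fun _ => zero_le) x
    rw [mem_ball_zero_iff]
    have := hy.2
    linarith
  calc ENNReal.ofReal r ^ expSum p = 2 ^ expSum p * ENNReal.ofReal (r / 2) ^ expSum p := by
        rw [← ENNReal.mul_rpow_of_nonneg _ _ hE, show (2 : ℝ≥0∞) = ENNReal.ofReal 2 by simp,
          ← ENNReal.ofReal_mul zero_le_two]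
        congr 2; ring
    _ ≤ 2 ^ expSum p * (ENNReal.ofReal √n ^ expSum p * ballNorm p r) := by
        gcongr
        exact h.trans (by gcongr)
    _ = _ := by ring

theorem ofReal_rpow_ne_zero {r : ℝ} (hr : 0 < r) (s : ℝ) : ENNReal.ofReal r ^ s ≠ 0 := by
  simp [hr, ENNReal.rpow_eq_zero_iff]

theorem ofReal_rpow_ne_top {r : ℝ} (hr : 0 < r) (s : ℝ) : ENNReal.ofReal r ^ s ≠ ∞ := by
  simp [hr, ENNReal.rpow_eq_top_iff]

theorem ballNorm_ne_top (hp : ∀ i, 0 < p i) {r : ℝ} (hr : 0 < r) : ballNorm p r ≠ ∞ := by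
  obtain ⟨c, hc, h⟩ := exists_ballNorm_le hp
  exact ne_top_of_le_ne_top (ENNReal.mul_ne_top hc (ofReal_rpow_ne_top hr _)) (h r hr)

theorem ballNorm_ne_zero (hn : 1 ≤ n) (hp : ∀ i, 0 < p i) {r : ℝ} (hr : 0 < r) :
    ballNorm p r ≠ 0 := by
  obtain ⟨c, -, h⟩ := exists_le_ballNorm hn hp
  intro h0
  have := h r hr
  rw [h0, mul_zero] at this
  exact ofReal_rpow_ne_zero hr _ (le_antisymm this zero_le)

theorem exists_ball_le_cmoNorm (hn : 1 ≤ n) (hp : ∀ i, 0 < p i) :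
    ∃ c : ℝ≥0∞, c ≠ ∞ ∧ ∀ (f : Rn n → ℂ) (r : ℝ), 0 < r →
      mixedENorm p ((ball (0 : Rn n) r).indicator
        fun x => ‖f x - ⨍ t in ball (0 : Rn n) r, f t‖ₑ) ≤
          c * ENNReal.ofReal r ^ expSum p * cmoNorm p f := by
  obtain ⟨c, hc, h⟩ := exists_ballNorm_le hp
  refine ⟨c, hc, fun f r hr => ?_⟩
  rw [← mixedNorm_indicator p _ fun x => f x - ⨍ t in ball (0 : Rn n) r, f t]
  exact le_mul_iSup_div (F := fun r => mixedNorm p ((ball (0 : Rn n) r).indicator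
    fun x => f x - ⨍ t in ball (0 : Rn n) r, f t)) (fun r => ballNorm_ne_zero hn hp)
    (fun r => ballNorm_ne_top hp) h hr

theorem exists_cmoNorm_le (hn : 1 ≤ n) (hp : ∀ i, 0 < p i) :
    ∃ c : ℝ≥0∞, c ≠ ∞ ∧ ∀ (f : Rn n → ℂ) (A : ℝ≥0∞), (∀ r : ℝ, 0 < r →
      mixedENorm p ((ball (0 : Rn n) r).indicator
        fun x => ‖f x - ⨍ t in ball (0 : Rn n) r, f t‖ₑ) ≤ A * ENNReal.ofReal r ^ expSum p) →
      cmoNorm p f ≤ c * A := by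
  obtain ⟨c, hc, h⟩ := exists_le_ballNorm hn hp
  refine ⟨c, hc, fun f A hA => iSup_div_le_mul h fun r hr => ?_⟩
  rw [mixedNorm_indicator]
  exact hA r hr

theorem morrey_denom_eq (lam : ℝ) {r : ℝ} (hr : 0 < r) :
    volume (ball (0 : Rn n) r) ^ lam * ballNorm p r =
      ENNReal.ofReal r ^ (n * lam) * (volume (ball (0 : Rn n) 1) ^ lam * ballNorm p r) := by
  rw [Measure.addHaar_ball_of_pos _ _ hr, finrank_euclideanSpace_fin,
    ENNReal.mul_rpow_of_ne_top (by simp) measure_ball_lt_top.ne, ENNReal.ofReal_pow hr.le,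
    ← ENNReal.rpow_natCast, ← ENNReal.rpow_mul, mul_assoc]

theorem volume_ball_rpow_ne_top (lam : ℝ) : volume (ball (0 : Rn n) 1) ^ lam ≠ ∞ := by
  simp [ENNReal.rpow_eq_top_iff, (measure_ball_pos volume (0 : Rn n) one_pos).ne',
    measure_ball_lt_top.ne]

theorem volume_ball_rpow_ne_zero (lam : ℝ) : volume (ball (0 : Rn n) 1) ^ lam ≠ 0 := by
  simp [ENNReal.rpow_eq_zero_iff, (measure_ball_pos volume (0 : Rn n) one_pos).ne',
    measure_ball_lt_top.ne]

theorem ofReal_rpow_add {r : ℝ} (hr : 0 < r) (s t : ℝ) :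
    ENNReal.ofReal r ^ (s + t) = ENNReal.ofReal r ^ s * ENNReal.ofReal r ^ t :=
  ENNReal.rpow_add _ _ (by simpa using hr) (by simp)

/-- Since |B_r|^λ ‖χ_{B_r}‖_p is of order r^(nλ + `expSum p`), this exponent is the only trace of λ
in later estimates. -/
theorem exists_ball_le_morreyNorm (hn : 1 ≤ n) (hp : ∀ i, 0 < p i) (lam : ℝ) :
    ∃ c : ℝ≥0∞, c ≠ ∞ ∧ ∀ (f : Rn n → ℂ) (r : ℝ), 0 < r →
      mixedENorm p ((ball (0 : Rn n) r).indicator fun x => ‖f x‖ₑ) ≤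
        c * ENNReal.ofReal r ^ (n * lam + expSum p) * morreyNorm p lam f := by
  obtain ⟨c, hc, h⟩ := exists_ballNorm_le hp
  refine ⟨volume (ball (0 : Rn n) 1) ^ lam * c,
    ENNReal.mul_ne_top (volume_ball_rpow_ne_top lam) hc, fun f r hr => ?_⟩
  rw [← mixedNorm_indicator]
  refine le_mul_iSup_div (F := fun r => mixedNorm p ((ball (0 : Rn n) r).indicator f))
    (fun r hr => ?_) (fun r hr => ?_) (fun r hr => ?_) hr
  · rw [morrey_denom_eq lam hr]
    exact mul_ne_zero (ofReal_rpow_ne_zero hr _)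
      (mul_ne_zero (volume_ball_rpow_ne_zero lam) (ballNorm_ne_zero hn hp hr))
  · rw [morrey_denom_eq lam hr]
    exact ENNReal.mul_ne_top (ofReal_rpow_ne_top hr _)
      (ENNReal.mul_ne_top (volume_ball_rpow_ne_top lam) (ballNorm_ne_top hp hr))
  · rw [morrey_denom_eq lam hr, ofReal_rpow_add hr]
    calc _ ≤ ENNReal.ofReal r ^ (n * lam) * (volume (ball (0 : Rn n) 1) ^ lam *
          (c * ENNReal.ofReal r ^ expSum p)) := by gcongr; exact h r hr
      _ = _ := by ring

theorem exists_morreyNorm_le (hn : 1 ≤ n) (hp : ∀ i, 0 < p i) (lam : ℝ) :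
    ∃ c : ℝ≥0∞, c ≠ ∞ ∧ ∀ (f : Rn n → ℂ) (A : ℝ≥0∞), (∀ r : ℝ, 0 < r →
      mixedENorm p ((ball (0 : Rn n) r).indicator fun x => ‖f x‖ₑ) ≤
        A * ENNReal.ofReal r ^ (n * lam + expSum p)) → morreyNorm p lam f ≤ c * A := by
  obtain ⟨c, hc, h⟩ := exists_le_ballNorm hn hp
  refine ⟨(volume (ball (0 : Rn n) 1) ^ lam)⁻¹ * c,
    ENNReal.mul_ne_top (ENNReal.inv_ne_top.2 (volume_ball_rpow_ne_zero lam)) hc, fun f A hA =>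
    iSup_div_le_mul (s := n * lam + expSum p) (fun r hr => ?_) fun r hr => ?_⟩
  · rw [morrey_denom_eq lam hr, ofReal_rpow_add hr]
    calc _ ≤ ENNReal.ofReal r ^ (n * lam) * (c * ballNorm p r) := by gcongr; exact h r hr
      _ = ((volume (ball (0 : Rn n) 1) ^ lam)⁻¹ * volume (ball (0 : Rn n) 1) ^ lam) *
          (ENNReal.ofReal r ^ (n * lam) * (c * ballNorm p r)) := by
        rw [ENNReal.inv_mul_cancel (volume_ball_rpow_ne_zero lam) (volume_ball_rpow_ne_top lam),
          one_mul]
      _ = _ := by ring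
  · rw [mixedNorm_indicator]
    exact hA r hr

end Interface

/-! ### CMO as oscillation on dyadic shells -/

section Oscillation

variable {n : ℕ} {p q : Fin n → ℝ}

/-- The function `b` is close to the constant `m k` on the `k`-th dyadic shell, in the normalized
mixed norm, and the constants of adjacent shells are close to each other. -/
structure ShellOsc (p : Fin n → ℝ) (b : Rn n → ℂ) (m : ℤ → ℂ) (A : ℝ≥0∞) : Prop where
  osc : ∀ k : ℤ, mixedENorm p ((shell k : Set (Rn n)).indicator fun x => ‖b x - m k‖ₑ) ≤
    A * pow2 (k * expSum p)
  drift : ∀ k : ℤ, ‖m (k + 1) - m k‖ₑ ≤ A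

theorem ShellOsc.mono {b : Rn n → ℂ} {m : ℤ → ℂ} {A B : ℝ≥0∞} (h : ShellOsc p b m A)
    (hAB : A ≤ B) : ShellOsc p b m B :=
  ⟨fun k => (h.osc k).trans (by gcongr), fun k => (h.drift k).trans hAB⟩

theorem enorm_sub_le_of_drift {m : ℤ → ℂ} {A : ℝ≥0∞} (h : ∀ k : ℤ, ‖m (k + 1) - m k‖ₑ ≤ A)
    (j k : ℤ) : ‖m j - m k‖ₑ ≤ A * ((k - j).natAbs : ℝ≥0∞) := by
  have key : ∀ (d : ℕ) (k : ℤ), ‖m (k + d) - m k‖ₑ ≤ A * d := by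
    intro d k
    induction d with
    | zero => simp
    | succ d ih =>
      have e : m (k + (d + 1 : ℕ)) - m k = (m (k + d + 1) - m (k + d)) + (m (k + d) - m k) := by
        push_cast
        rw [← add_assoc]
        ring
      rw [e]
      calc _ ≤ ‖m (k + d + 1) - m (k + d)‖ₑ + ‖m (k + d) - m k‖ₑ := enorm_add_le _ _
        _ ≤ A + A * d := add_le_add (h _) ih
        _ = _ := by push_cast; ring
  rcases le_total j k with hjk | hjk
  · obtain ⟨d, rfl⟩ := Int.le.dest hjk
    rw [enorm_sub_rev]
    simpa using key d j
  · obtain ⟨d, rfl⟩ := Int.le.dest hjk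
    simpa using key d k

theorem le_of_mul_pow2_le {x A : ℝ≥0∞} {s : ℝ} (h : x * pow2 s ≤ A * pow2 s) : x ≤ A := by
  have := mul_le_mul_left h (pow2 (-s))
  simpa [mul_assoc, pow2_mul_pow2_neg] using this

theorem measurable_enorm_sub_const {b : Rn n → ℂ} (hb : Measurable b) (c : ℂ) :
    Measurable fun x => ‖b x - c‖ₑ :=
  (hb.sub_const c).enorm

theorem indicator_enorm_sub_le (s : Set (Rn n)) (b : Rn n → ℂ) (c d : ℂ) (x : Rn n) :
    s.indicator (fun x => ‖b x - d‖ₑ) x ≤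
      s.indicator (fun x => ‖b x - c‖ₑ) x + ‖c - d‖ₑ * s.indicator 1 x := by
  by_cases hx : x ∈ s
  · simp only [indicator_of_mem hx, Pi.one_apply, mul_one]
    rw [← sub_add_sub_cancel (b x) c d]
    exact enorm_add_le _ _
  · simp [hx]

/-- Replacing the constant in the oscillation on a set. -/
theorem mixedENorm_osc_le (hp : ∀ i, 1 < p i) {s : Set (Rn n)} (hs : MeasurableSet s)
    {b : Rn n → ℂ} (hb : Measurable b) (c d : ℂ) :
    mixedENorm p (s.indicator fun x => ‖b x - d‖ₑ) ≤
      mixedENorm p (s.indicator fun x => ‖b x - c‖ₑ) +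
        ‖c - d‖ₑ * mixedENorm p (s.indicator 1) := by
  have hp0 : ∀ i, 0 < p i := fun i => zero_lt_one.trans (hp i)
  have h1 : Measurable (s.indicator (1 : Rn n → ℝ≥0∞)) := measurable_one.indicator hs
  rw [← mixedENorm_const_mul hp0 _ h1.aemeasurable]
  exact (mixedENorm_mono hp0 (indicator_enorm_sub_le s b c d)).trans
    (mixedENorm_add_le hp ((measurable_enorm_sub_const hb c).indicator hs).aemeasurable
      (h1.const_mul _).aemeasurable)

/-- If one function is close to two constants on the same set, the constants are close to each
other. -/
theorem enorm_sub_mul_mixedENorm_le (hp : ∀ i, 1 < p i) {s : Set (Rn n)} (hs : MeasurableSet s)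
    {b : Rn n → ℂ} (hb : Measurable b) (c d : ℂ) :
    ‖c - d‖ₑ * mixedENorm p (s.indicator 1) ≤
      mixedENorm p (s.indicator fun x => ‖b x - c‖ₑ) +
        mixedENorm p (s.indicator fun x => ‖b x - d‖ₑ) := by
  have hp0 : ∀ i, 0 < p i := fun i => zero_lt_one.trans (hp i)
  have h1 : Measurable (s.indicator (1 : Rn n → ℝ≥0∞)) := measurable_one.indicator hs
  rw [← mixedENorm_const_mul hp0 _ h1.aemeasurable]
  refine (mixedENorm_mono hp0 fun x => ?_).trans
    (mixedENorm_add_le hp ((measurable_enorm_sub_const hb c).indicator hs).aemeasurable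
      ((measurable_enorm_sub_const hb d).indicator hs).aemeasurable)
  by_cases hx : x ∈ s
  · simp only [indicator_of_mem hx, Pi.one_apply, mul_one]
    rw [← sub_add_sub_cancel c (b x) d, enorm_sub_rev (b x) c]
    exact enorm_add_le _ _
  · simp [hx]

/-- The right side is infinite unless b - c, hence b, is integrable on s; so the default value 0 of
the average causes no trouble. -/
theorem enorm_setAverage_sub_mul_le {s : Set (Rn n)} (hs : volume s ≠ ∞)
    {b : Rn n → ℂ} (hb : Measurable b) (c : ℂ) :
    ‖(⨍ t in s, b t) - c‖ₑ * volume s ≤ ∫⁻ t in s, ‖b t - c‖ₑ := by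
  rcases eq_or_ne (∫⁻ t in s, ‖b t - c‖ₑ) ∞ with h | h
  · simp [h]
  have hc : IntegrableOn (fun _ : Rn n => c) s := integrableOn_const hs
  have hi : IntegrableOn (fun t => b t - c) s :=
    ⟨(hb.sub_const c).aestronglyMeasurable, h.lt_top⟩
  have hbi : IntegrableOn b s := by
    have e : (fun t => b t - c) + (fun _ => c) = b := by ext; simp
    exact e ▸ hi.add hc
  have e : (volume s).toReal • ((⨍ t in s, b t) - c) = ∫ t in s, (b t - c) := by
    rw [integral_sub hbi hc, setIntegral_const, smul_sub, ← measure_smul_setAverage _ hs]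
    rfl
  have h2 : ‖(volume s).toReal • ((⨍ t in s, b t) - c)‖ₑ =
      ‖(⨍ t in s, b t) - c‖ₑ * volume s := by
    rw [enorm_smul, mul_comm, Real.enorm_of_nonneg ENNReal.toReal_nonneg, ENNReal.ofReal_toReal hs]
  rw [← h2, e]
  exact enorm_integral_le_lintegral_enorm _

/-- The k-th shell lies in the balls of radius 2^(k+1) and 2^(k+2), so b is close on it to both
averages; the first comparison is `osc`, the two together give `drift`. Only closeness to some
constant matters, so integrability of b never enters. -/
theorem exists_shellOsc_of_cmoNorm (hn : 1 ≤ n) (hp : ∀ i, 1 < p i) {b : Rn n → ℂ}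
    (hb : Measurable b) (h : cmoNorm p b < ∞) :
    ∃ A : ℝ≥0∞, A ≠ ∞ ∧
      ShellOsc p b (fun k => ⨍ t in ball (0 : Rn n) (2 ^ ((k : ℝ) + 1)), b t) A := by
  have hp0 : ∀ i, 0 < p i := fun i => zero_lt_one.trans (hp i)
  obtain ⟨c, hc, h1⟩ := exists_ball_le_cmoNorm hn hp0
  obtain ⟨d, hd, h2⟩ := exists_pow2_le_mixedENorm_shell hn hp0
  set m : ℤ → ℂ := fun k => ⨍ t in ball (0 : Rn n) (2 ^ ((k : ℝ) + 1)), b t with hm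
  set B := c * cmoNorm p b with hB
  have hBt : B ≠ ∞ := ENNReal.mul_ne_top hc h.ne
  have hball : ∀ k l : ℤ, k ≤ l → mixedENorm p ((shell k : Set (Rn n)).indicator
      fun x => ‖b x - m l‖ₑ) ≤ B * pow2 ((l + 1) * expSum p) := by
    intro k l hkl
    have hle : (2 : ℝ) ^ ((k : ℝ) + 1) ≤ 2 ^ ((l : ℝ) + 1) :=
      Real.rpow_le_rpow_of_exponent_le one_le_two (by exact_mod_cast add_le_add_left hkl 1)
    refine (mixedENorm_mono hp0 fun x => indicator_le_indicator_of_subset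
      ((shell_subset_ball k).trans (ball_subset_ball hle)) (fun _ => zero_le) x).trans
      ((h1 b _ (by positivity)).trans (le_of_eq ?_))
    rw [ofReal_two_rpow, pow2_rpow, hB]
    ring
  have hE := pow2_ne_top (expSum p)
  refine ⟨B * pow2 (expSum p) + d * (B * pow2 (2 * expSum p) + B * pow2 (expSum p)), ?_, ?_, ?_⟩
  · exact ENNReal.add_ne_top.2 ⟨ENNReal.mul_ne_top hBt hE, ENNReal.mul_ne_top hd
      (ENNReal.add_ne_top.2 ⟨ENNReal.mul_ne_top hBt (pow2_ne_top _), ENNReal.mul_ne_top hBt hE⟩)⟩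
  · intro k
    refine (hball k k le_rfl).trans ?_
    rw [show ((k : ℝ) + 1) * expSum p = expSum p + k * expSum p by ring, pow2_add, ← mul_assoc]
    gcongr
    exact le_self_add
  · intro k
    refine le_trans ?_ le_add_self
    refine le_of_mul_pow2_le (s := k * expSum p) ?_
    calc ‖m (k + 1) - m k‖ₑ * pow2 (k * expSum p)
        ≤ ‖m (k + 1) - m k‖ₑ * (d * mixedENorm p ((shell k : Set (Rn n)).indicator 1)) := by
          gcongr; exact h2 k
      _ = d * (‖m (k + 1) - m k‖ₑ * mixedENorm p ((shell k : Set (Rn n)).indicator 1)) := by ring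
      _ ≤ d * (B * pow2 (((k + 1 : ℤ) + 1) * expSum p) + B * pow2 ((k + 1) * expSum p)) := by
          gcongr
          exact (enorm_sub_mul_mixedENorm_le hp (measurableSet_shell k) hb _ _).trans
            (add_le_add (hball k (k + 1) (by lia)) (hball k k le_rfl))
      _ = _ := by
          rw [show (((k + 1 : ℤ) : ℝ) + 1) * expSum p = 2 * expSum p + k * expSum p by
            push_cast; ring, show ((k : ℝ) + 1) * expSum p = expSum p + k * expSum p by ring,
            pow2_add, pow2_add]
          ring

/-- Replacing `m j` by `m k` on the j-th shell costs |j - k| drift steps. -/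
theorem exists_shell_osc_le (hp : ∀ i, 1 < p i) {b : Rn n → ℂ} (hb : Measurable b) {m : ℤ → ℂ}
    {A : ℝ≥0∞} (hA : A ≠ ∞) (h : ShellOsc p b m A) :
    ∃ C : ℝ≥0∞, C ≠ ∞ ∧ ∀ j k : ℤ,
      mixedENorm p ((shell j : Set (Rn n)).indicator fun x => ‖b x - m k‖ₑ) ≤
        C * ((1 + ((k - j).natAbs : ℝ≥0∞)) * pow2 (j * expSum p)) := by
  obtain ⟨c, hc, h1⟩ := exists_mixedENorm_shell_le fun i => zero_lt_one.trans (hp i)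
  refine ⟨A * (1 + c), ENNReal.mul_ne_top hA (by simp [hc]), fun j k => ?_⟩
  calc _ ≤ A * pow2 (j * expSum p) +
      A * ((k - j).natAbs : ℝ≥0∞) * (c * pow2 (j * expSum p)) :=
        (mixedENorm_osc_le hp (measurableSet_shell j) hb (m j) (m k)).trans (add_le_add (h.osc j)
          (mul_le_mul' (enorm_sub_le_of_drift h.drift j k) (h1 j)))
    _ = A * (1 + ((k - j).natAbs : ℝ≥0∞) * c) * pow2 (j * expSum p) := by ring
    _ ≤ A * ((1 + c) * (1 + ((k - j).natAbs : ℝ≥0∞))) * pow2 (j * expSum p) := by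
        gcongr
        rw [show (1 + c) * (1 + ((k - j).natAbs : ℝ≥0∞)) =
          1 + ((k - j).natAbs : ℝ≥0∞) * c + (c + ((k - j).natAbs : ℝ≥0∞)) by ring]
        exact le_self_add
    _ = _ := by ring

theorem int_le_of_two_rpow_lt {j k : ℤ} {r : ℝ} (hj : (2 : ℝ) ^ (j : ℝ) < r)
    (hk : r ≤ 2 * 2 ^ (k : ℝ)) : j ≤ k := by
  have h := hj.trans_le hk
  rw [two_mul_two_rpow, Real.rpow_lt_rpow_left_iff one_lt_two] at h
  exact Int.lt_add_one_iff.1 (by exact_mod_cast h)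

/-- Summing shell estimates over all shells meeting a ball. -/
theorem exists_tsum_shell_le {s : ℝ} (hs : 0 < s) :
    ∃ W : ℝ≥0∞, W ≠ ∞ ∧ ∀ (F : ℤ → ℝ≥0∞) (C : ℝ≥0∞) (k : ℤ) (r : ℝ), r ≤ 2 * 2 ^ (k : ℝ) →
      (∀ j ≤ k, F j ≤ C * ((1 + ((k - j).natAbs : ℝ≥0∞)) * pow2 (j * s))) →
      ∑' j : ℤ, (if (2 : ℝ) ^ (j : ℝ) < r then F j else 0) ≤ C * W * pow2 (k * s) := by
  -- For j ≤ k, 2^(js) = 2^(-s|k-j|) · 2^(ks), so the sum is dominated by the weight sum with δ = s.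
  refine ⟨_, tsum_weight_ne_top hs, fun F C k r hr hF => ?_⟩
  rw [← tsum_sub_left (fun m : ℤ => (1 + (m.natAbs : ℝ≥0∞)) * pow2 (-(s * m.natAbs))) k,
    mul_assoc, ← ENNReal.tsum_mul_right, ← ENNReal.tsum_mul_left]
  refine ENNReal.tsum_le_tsum fun j => ?_
  split_ifs with hj
  · have hjk : j ≤ k := int_le_of_two_rpow_lt hj hr
    refine (hF j hjk).trans (le_of_eq ?_)
    rw [mul_assoc (1 + _), ← pow2_add]
    congr 3
    have : (((k - j).natAbs : ℕ) : ℝ) = k - j := by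
      rw [Nat.cast_natAbs, abs_of_nonneg (by lia)]
      push_cast; ring
    rw [this]
    ring
  · exact zero_le

/-- Summing shells shows that b is close to `m k` on the whole ball when 2^k ≤ r < 2^(k+1). Hölder
then makes the ball average close to `m k`, which it may replace. -/
theorem cmoNorm_lt_top_of_shellOsc (hn : 1 ≤ n) (hpq : ∀ i, (p i).HolderConjugate (q i))
    {b : Rn n → ℂ} (hb : Measurable b) {m : ℤ → ℂ} {A : ℝ≥0∞} (hA : A ≠ ∞)
    (h : ShellOsc p b m A) : cmoNorm p b < ∞ := by
  have hp : ∀ i, 1 < p i := fun i => (hpq i).lt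
  have hp0 : ∀ i, 0 < p i := fun i => (hpq i).pos
  have hq0 : ∀ i, 0 < q i := fun i => (hpq i).symm.pos
  obtain ⟨C, hC, h1⟩ := exists_shell_osc_le hp hb hA h
  obtain ⟨W, hW, h2⟩ := exists_tsum_shell_le (expSum_pos hn hp0)
  obtain ⟨c, hc, h3⟩ := exists_cmoNorm_le hn hp0
  have hEp := expSum_nonneg hp0
  have hEq := expSum_nonneg hq0
  set V := volume (ball (0 : Rn n) 1) with hV
  have hV0 : V ≠ 0 := (measure_ball_pos volume (0 : Rn n) one_pos).ne'
  have hVt : V ≠ ∞ := measure_ball_lt_top.ne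
  set a : ℝ≥0∞ := 2 ^ expSum p with ha
  set a' : ℝ≥0∞ := 2 ^ expSum q with ha'
  have hat : a ≠ ∞ := ENNReal.rpow_ne_top_of_nonneg hEp (by simp)
  have hat' : a' ≠ ∞ := ENNReal.rpow_ne_top_of_nonneg hEq (by simp)
  have hD : C * W * a' * V⁻¹ ≠ ∞ := ENNReal.mul_ne_top (ENNReal.mul_ne_top
    (ENNReal.mul_ne_top hC hW) hat') (ENNReal.inv_ne_top.2 hV0)
  refine (h3 b (C * W + C * W * a' * V⁻¹ * a) fun r hr => ?_).trans_lt (ENNReal.mul_lt_top hc.lt_top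
    (ENNReal.add_lt_top.2 ⟨(ENNReal.mul_ne_top hC hW).lt_top,
      (ENNReal.mul_ne_top hD hat).lt_top⟩))
  obtain ⟨k, hk1, hk2⟩ := exists_dyadic hr
  have hosc : mixedENorm p ((ball (0 : Rn n) r).indicator fun x => ‖b x - m k‖ₑ) ≤
      C * W * ENNReal.ofReal r ^ expSum p := by
    refine (mixedENorm_ball_le_tsum hn hp (measurable_enorm_sub_const hb _) r).trans
      ((h2 _ C k r hk2.le fun j _ => h1 j k).trans ?_)
    gcongr
    rw [← pow2_rpow, ← ofReal_two_rpow]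
    exact ENNReal.rpow_le_rpow (ENNReal.ofReal_le_ofReal hk1) hEp
  have hvol : volume (ball (0 : Rn n) r) = ENNReal.ofReal r ^ expSum p *
      ENNReal.ofReal r ^ expSum q * V := by
    rw [Measure.addHaar_ball_of_pos _ _ hr, finrank_euclideanSpace_fin, ← ofReal_rpow_add hr,
      expSum_add_conj hpq, ENNReal.rpow_natCast, ENNReal.ofReal_pow hr.le]
  have hrp := ofReal_rpow_ne_zero hr (expSum p)
  have hrq := ofReal_rpow_ne_zero hr (expSum q)
  have hrpt := ofReal_rpow_ne_top hr (expSum p)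
  have hrqt := ofReal_rpow_ne_top hr (expSum q)
  -- The powers of r cancel because |B_r| = r^`expSum p` · r^`expSum q` · |B_1|.
  have havg : ‖m k - ⨍ t in ball (0 : Rn n) r, b t‖ₑ ≤ C * W * a' * V⁻¹ := by
    have h4 := (enorm_setAverage_sub_mul_le (s := ball (0 : Rn n) r) measure_ball_lt_top.ne hb (m k)).trans
      (setLIntegral_le_mixedENorm hpq measurableSet_ball
        (measurable_enorm_sub_const hb (m k)).aemeasurable)
    have h5 := h4.trans (mul_le_mul' hosc (mixedENorm_ball_le hq0 hr))
    rw [hvol] at h5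
    rw [enorm_sub_rev]
    set X := ENNReal.ofReal r ^ expSum p * ENNReal.ofReal r ^ expSum q with hX
    have hX0 : X ≠ 0 := mul_ne_zero hrp hrq
    have hXt : X ≠ ∞ := ENNReal.mul_ne_top hrpt hrqt
    rw [← ENNReal.div_eq_inv_mul.trans (mul_comm _ _), ENNReal.le_div_iff_mul_le (Or.inl hV0)
      (Or.inl hVt)]
    refine (ENNReal.mul_le_mul_iff_left hX0 hXt).1 ?_
    calc _ = ‖(⨍ t in ball (0 : Rn n) r, b t) - m k‖ₑ * (X * V) := by ring
      _ ≤ _ := h5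
      _ = _ := by rw [hX]; ring
  calc _ ≤ C * W * ENNReal.ofReal r ^ expSum p + C * W * a' * V⁻¹ *
        (a * ENNReal.ofReal r ^ expSum p) :=
      (mixedENorm_osc_le hp measurableSet_ball hb (m k) _).trans
        (add_le_add hosc (mul_le_mul' havg (mixedENorm_ball_le hp0 hr)))
    _ = _ := by ring

end Oscillation

/-! ### The positive majorant of both commutators -/

section Majorant

variable {n : ℕ} {p q : Fin n → ℝ}

/-- The kernel `max(|x|, |t|)⁻ⁿ`. -/
def maxKernel (x t : Rn n) : ℝ≥0∞ := ((‖x‖ₑ ⊔ ‖t‖ₑ) ^ n)⁻¹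

theorem measurable_maxKernel : Measurable fun z : Rn n × Rn n => maxKernel z.1 z.2 :=
  ((measurable_fst.enorm.max measurable_snd.enorm).pow_const n).inv

theorem measurable_maxKernel_left (x : Rn n) : Measurable fun t => maxKernel x t :=
  ((measurable_const.max measurable_enorm).pow_const n).inv

/-- A positive operator which dominates the commutators of both Hardy operators. -/
def majorant (b : Rn n → ℂ) (g : Rn n → ℝ≥0∞) (x : Rn n) : ℝ≥0∞ :=
  ∫⁻ t, (1 + ‖b x - b t‖ₑ) * g t * maxKernel x t

theorem measurable_majorant_integrand {b : Rn n → ℂ} (hb : Measurable b) {g : Rn n → ℝ≥0∞}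
    (hg : Measurable g) :
    Measurable fun z : Rn n × Rn n => (1 + ‖b z.1 - b z.2‖ₑ) * g z.2 * maxKernel z.1 z.2 :=
  ((measurable_const.add ((hb.comp measurable_fst).sub (hb.comp measurable_snd)).enorm).mul
    (hg.comp measurable_snd)).mul measurable_maxKernel

theorem measurable_majorant {b : Rn n → ℂ} (hb : Measurable b) {g : Rn n → ℝ≥0∞}
    (hg : Measurable g) : Measurable (majorant b g) :=
  (measurable_majorant_integrand hb hg).lintegral_prod_right'

theorem majorant_congr_ae {b : Rn n → ℂ} {g h : Rn n → ℝ≥0∞} (hgh : g =ᵐ[volume] h) :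
    majorant b g = majorant b h := by
  ext x
  refine lintegral_congr_ae ?_
  filter_upwards [hgh] with t ht using by rw [ht]

theorem majorant_zero (b : Rn n → ℂ) : majorant b (fun _ => 0) = fun _ => 0 := by
  ext x
  simp [majorant]

theorem maxKernel_le {j k : ℤ} {x t : Rn n} (hx : x ∈ (shell k : Set (Rn n)))
    (ht : t ∈ (shell j : Set (Rn n))) : maxKernel x t ≤ pow2 (-((max j k : ℤ) * n)) := by
  have h : pow2 (max j k : ℤ) ≤ ‖x‖ₑ ⊔ ‖t‖ₑ := by
    rcases max_choice j k with h | h <;> rw [h]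
    · exact (pow2_le_enorm ht).trans le_sup_right
    · exact (pow2_le_enorm hx).trans le_sup_left
  have h2 : pow2 (-((max j k : ℤ) * n)) = (pow2 (max j k : ℤ) ^ n)⁻¹ := by
    rw [← ENNReal.rpow_natCast, pow2_rpow, pow2, pow2, ENNReal.rpow_neg]
  rw [h2]
  exact ENNReal.inv_le_inv.2 (pow_le_pow_left' h n)

/-- The discrete kernel which governs the majorant on dyadic shells. -/
def shellKernel (n : ℕ) (s : ℝ) (m : ℤ) : ℝ≥0∞ :=
  (1 + (m.natAbs : ℝ≥0∞)) * pow2 (m * s - (max m 0 : ℤ) * n)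

theorem exists_setLIntegral_shell_le (hpq : ∀ i, (p i).HolderConjugate (q i)) :
    ∃ c : ℝ≥0∞, c ≠ ∞ ∧ ∀ (g : Rn n → ℝ≥0∞), Measurable g → ∀ j : ℤ,
      ∫⁻ t in shell j, g t ≤
        c * (pow2 (j * expSum q) * mixedENorm p ((shell j : Set (Rn n)).indicator g)) := by
  obtain ⟨c, hc, h⟩ := exists_mixedENorm_shell_le fun i => (hpq i).symm.pos
  refine ⟨c, hc, fun g hg j => ?_⟩
  calc _ ≤ mixedENorm p ((shell j : Set (Rn n)).indicator g) * (c * pow2 (j * expSum q)) :=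
        (setLIntegral_le_mixedENorm hpq (measurableSet_shell j) hg.aemeasurable).trans
          (mul_le_mul' le_rfl (h j))
    _ = _ := by ring

theorem setLIntegral_shell_osc_mul_le (hpq : ∀ i, (p i).HolderConjugate (q i))
    {b : Rn n → ℂ} (hb : Measurable b) {m : ℤ → ℂ} {A : ℝ≥0∞} (hm : ShellOsc q b m A)
    {g : Rn n → ℝ≥0∞} (hg : Measurable g) (j : ℤ) :
    ∫⁻ t in shell j, ‖b t - m j‖ₑ * g t ≤
      A * (pow2 (j * expSum q) * mixedENorm p ((shell j : Set (Rn n)).indicator g)) := by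
  rw [← lintegral_indicator (measurableSet_shell j)]
  calc _ = ∫⁻ t, (shell j : Set (Rn n)).indicator g t *
        (shell j : Set (Rn n)).indicator (fun t => ‖b t - m j‖ₑ) t := by
        refine lintegral_congr fun t => ?_
        by_cases ht : t ∈ (shell j : Set (Rn n)) <;> simp [ht, mul_comm]
    _ ≤ mixedENorm p ((shell j : Set (Rn n)).indicator g) * (A * pow2 (j * expSum q)) :=
        (lintegral_mul_le_mixedENorm hpq (hg.indicator (measurableSet_shell j)).aemeasurable
          ((measurable_enorm_sub_const hb _).indicator
            (measurableSet_shell j)).aemeasurable).trans (mul_le_mul' le_rfl (hm.osc j))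
    _ = _ := by ring

/-- b(x) - b(t) = (b(x) - m_k) + (m_k - m_j) - (b(t) - m_j): an x-oscillation, a drift and a
t-oscillation, with the kernel frozen at the larger of the two scales. -/
theorem majorant_integrand_le {b : Rn n → ℂ} {m : ℤ → ℂ} {A : ℝ≥0∞}
    (hm : ∀ k : ℤ, ‖m (k + 1) - m k‖ₑ ≤ A) (g : Rn n → ℝ≥0∞) {j k : ℤ} {x t : Rn n}
    (hx : x ∈ (shell k : Set (Rn n))) (ht : t ∈ (shell j : Set (Rn n))) :
    (1 + ‖b x - b t‖ₑ) * g t * maxKernel x t ≤ pow2 (-((max j k : ℤ) * n)) *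
      ((1 + ‖b x - m k‖ₑ + A * ((k - j).natAbs : ℝ≥0∞)) * g t + ‖b t - m j‖ₑ * g t) := by
  have h1 : ‖b x - b t‖ₑ ≤ ‖b x - m k‖ₑ + A * ((k - j).natAbs : ℝ≥0∞) + ‖b t - m j‖ₑ := by
    have e : b x - b t = (b x - m k) + (m k - m j) - (b t - m j) := by ring
    rw [e]
    refine enorm_sub_le.trans (add_le_add ((enorm_add_le _ _).trans
      (add_le_add le_rfl ?_)) le_rfl)
    rw [enorm_sub_rev]
    exact enorm_sub_le_of_drift hm j k
  calc _ ≤ (1 + (‖b x - m k‖ₑ + A * ((k - j).natAbs : ℝ≥0∞) + ‖b t - m j‖ₑ)) * g t *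
        pow2 (-((max j k : ℤ) * n)) :=
        mul_le_mul' (mul_le_mul' (add_le_add le_rfl h1) le_rfl) (maxKernel_le hx ht)
    _ = _ := by ring

theorem mul_one_add_add_le (c A d y : ℝ≥0∞) :
    c * (1 + y + A * d) + A ≤ (c * (1 + A) + A) * ((1 + d) * (1 + y)) := by
  rw [show (c * (1 + A) + A) * ((1 + d) * (1 + y)) = (c * (1 + y + A * d) + A) +
    (c * (A + d + d * y + y * A + d * y * A) + A * (d + y + d * y)) by ring]
  exact le_self_add

/-- Integrating over each shell by Hölder consumes the oscillation of b in the conjugate exponent q.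
All dependence on x inside the shell is left in the factor 1 + |b(x) - m_k|. -/
theorem exists_majorant_le (hn : 1 ≤ n) (hpq : ∀ i, (p i).HolderConjugate (q i))
    {b : Rn n → ℂ} (hb : Measurable b) {m : ℤ → ℂ} {A : ℝ≥0∞} (hA : A ≠ ∞)
    (hm : ShellOsc q b m A) :
    ∃ C : ℝ≥0∞, C ≠ ∞ ∧ ∀ (g : Rn n → ℝ≥0∞), Measurable g → ∀ k : ℤ,
      ∀ x ∈ (shell k : Set (Rn n)), majorant b g x ≤
        C * (∑' j : ℤ, (1 + ((k - j).natAbs : ℝ≥0∞)) * pow2 (j * expSum q - (max j k : ℤ) * n) *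
          mixedENorm p ((shell j : Set (Rn n)).indicator g)) * (1 + ‖b x - m k‖ₑ) := by
  obtain ⟨c, hc, h⟩ := exists_setLIntegral_shell_le hpq
  refine ⟨c * (1 + A) + A, ENNReal.add_ne_top.2 ⟨ENNReal.mul_ne_top hc
    (ENNReal.add_ne_top.2 ⟨ENNReal.one_ne_top, hA⟩), hA⟩, fun g hg k x hx => ?_⟩
  have hmeas : Measurable fun t => (1 + ‖b x - b t‖ₑ) * g t * maxKernel x t :=
    ((measurable_const.add (measurable_const.sub hb).enorm).mul hg).mul
      (measurable_maxKernel_left x)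
  rw [majorant, lintegral_eq_tsum_shell hn hmeas, mul_assoc, ← ENNReal.tsum_mul_right,
    ← ENNReal.tsum_mul_left]
  refine ENNReal.tsum_le_tsum fun j => ?_
  have hI := h g hg j
  have hO := setLIntegral_shell_osc_mul_le hpq hb hm hg j
  have hpt := setLIntegral_mono' (μ := volume) (measurableSet_shell j)
    fun t ht => majorant_integrand_le hm.drift g hx ht (b := b)
  have hm2 : Measurable fun t => ‖b t - m j‖ₑ * g t := (measurable_enorm_sub_const hb _).mul hg
  generalize mixedENorm p ((shell j : Set (Rn n)).indicator g) = F at hI hO ⊢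
  generalize ((k - j).natAbs : ℝ≥0∞) = d at hpt ⊢
  generalize ‖b x - m k‖ₑ = y at hpt ⊢
  rw [lintegral_const_mul (f := fun t => (1 + y + A * d) * g t + ‖b t - m j‖ₑ * g t) _
    ((hg.const_mul _).add hm2), lintegral_add_left (hg.const_mul _),
    lintegral_const_mul _ hg] at hpt
  refine hpt.trans ?_
  rw [sub_eq_add_neg, pow2_add]
  generalize pow2 (-((max j k : ℤ) * (n : ℝ))) = P
  generalize pow2 (j * expSum q) = Q at hI hO ⊢
  calc _ ≤ P * ((1 + y + A * d) * (c * (Q * F)) + A * (Q * F)) :=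
        mul_le_mul' le_rfl (add_le_add (mul_le_mul' le_rfl hI) hO)
    _ = (c * (1 + y + A * d) + A) * (P * Q * F) := by ring
    _ ≤ ((c * (1 + A) + A) * ((1 + d) * (1 + y))) * (P * Q * F) :=
        mul_le_mul' (mul_one_add_add_le c A d y) le_rfl
    _ = _ := by ring

/-- The p-norm of the remaining factor 1 + |b - m_k| is O(2^(k·`expSum p`)). Since `expSum p +
expSum q = n`, the combined power of two depends on k - j alone, so the bound is a convolution. -/
theorem exists_majorant_shell_le (hn : 1 ≤ n) (hpq : ∀ i, (p i).HolderConjugate (q i))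
    {b : Rn n → ℂ} (hb : Measurable b) {m : ℤ → ℂ} {A : ℝ≥0∞} (hA : A ≠ ∞)
    (hmp : ShellOsc p b m A) (hmq : ShellOsc q b m A) :
    ∃ C : ℝ≥0∞, C ≠ ∞ ∧ ∀ (g : Rn n → ℝ≥0∞), Measurable g → ∀ k : ℤ,
      mixedENorm p ((shell k : Set (Rn n)).indicator (majorant b g)) ≤
        C * ∑' j : ℤ, shellKernel n (expSum p) (k - j) *
          mixedENorm p ((shell j : Set (Rn n)).indicator g) := by
  have hp0 : ∀ i, 0 < p i := fun i => (hpq i).pos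
  obtain ⟨C, hC, h⟩ := exists_majorant_le hn hpq hb hA hmq
  obtain ⟨c, hc, h1⟩ := exists_mixedENorm_shell_le hp0
  refine ⟨C * (c + A), ENNReal.mul_ne_top hC (ENNReal.add_ne_top.2 ⟨hc, hA⟩), fun g hg k => ?_⟩
  set V := ∑' j : ℤ, (1 + ((k - j).natAbs : ℝ≥0∞)) * pow2 (j * expSum q - (max j k : ℤ) * n) *
    mixedENorm p ((shell j : Set (Rn n)).indicator g) with hV
  have hm1 : Measurable ((shell k : Set (Rn n)).indicator (1 : Rn n → ℝ≥0∞)) :=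
    measurable_one.indicator (measurableSet_shell k)
  have hm2 : Measurable ((shell k : Set (Rn n)).indicator fun x => ‖b x - m k‖ₑ) :=
    (measurable_enorm_sub_const hb _).indicator (measurableSet_shell k)
  have h2 : mixedENorm p ((shell k : Set (Rn n)).indicator (majorant b g)) ≤
      C * V * ((c + A) * pow2 (k * expSum p)) := by
    calc _ ≤ mixedENorm p fun x => C * V * ((shell k : Set (Rn n)).indicator 1 x +
          (shell k : Set (Rn n)).indicator (fun x => ‖b x - m k‖ₑ) x) := by
          refine mixedENorm_mono hp0 fun x => ?_
          by_cases hx : x ∈ (shell k : Set (Rn n))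
          · simpa only [indicator_of_mem hx, Pi.one_apply] using h g hg k x hx
          · simp [hx]
      _ ≤ C * V * (c * pow2 (k * expSum p) + A * pow2 (k * expSum p)) := by
          rw [mixedENorm_const_mul (g := fun x => (shell k : Set (Rn n)).indicator 1 x +
            (shell k : Set (Rn n)).indicator (fun x => ‖b x - m k‖ₑ) x) hp0 _
            (hm1.add hm2).aemeasurable]
          gcongr
          exact (mixedENorm_add_le (fun i => (hpq i).lt) hm1.aemeasurable hm2.aemeasurable).trans
            (add_le_add (h1 k) (hmp.osc k))
      _ = _ := by ring
  refine h2.trans (le_of_eq ?_)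
  calc _ = C * (c + A) * (pow2 (k * expSum p) * V) := by ring
    _ = _ := by
      rw [hV, ← ENNReal.tsum_mul_left]
      congr 1
      refine tsum_congr fun j => ?_
      have e : pow2 (k * expSum p) * pow2 (j * expSum q - (max j k : ℤ) * n) =
          pow2 ((k - j : ℤ) * expSum p - (max (k - j) 0 : ℤ) * n) := by
        rw [← pow2_add]
        congr 1
        have h3 : max (k - j) 0 = max j k - j := by lia
        rw [h3, ← expSum_add_conj hpq]
        push_cast
        ring
      rw [shellKernel, ← e]
      ring

/-- The exponent is m(s - t) for m ≤ 0 and m(s - t - n) for m ≥ 0; each hypothesis provides decay at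
one end. -/
theorem tsum_shellKernel_ne_top {s t : ℝ} (h1 : t < s) (h2 : s < t + n) :
    ∑' m : ℤ, shellKernel n s m * pow2 (-(m * t)) ≠ ∞ := by
  set δ := min (s - t) (t + n - s) with hδ
  have hδ0 : 0 < δ := lt_min (by linarith) (by linarith)
  refine ne_top_of_le_ne_top (tsum_weight_ne_top hδ0) (ENNReal.tsum_le_tsum fun m => ?_)
  rw [shellKernel, mul_assoc, ← pow2_add]
  gcongr
  refine pow2_mono ?_
  rcases le_total 0 m with hm | hm
  · have e : ((m.natAbs : ℕ) : ℝ) = m := by rw [Nat.cast_natAbs, abs_of_nonneg hm]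
    have hm' : (0 : ℝ) ≤ m := by exact_mod_cast hm
    rw [max_eq_left hm, e]
    nlinarith [min_le_right (s - t) (t + n - s)]
  · have e : ((m.natAbs : ℕ) : ℝ) = -m := by rw [Nat.cast_natAbs, abs_of_nonpos hm]; simp
    have hm' : (m : ℝ) ≤ 0 := by exact_mod_cast hm
    rw [max_eq_right hm, e]
    push_cast
    nlinarith [min_le_left (s - t) (t + n - s)]

theorem exists_majorant_ball_le_of_pos (hn : 1 ≤ n) (hpq : ∀ i, (p i).HolderConjugate (q i))
    {b : Rn n → ℂ} (hb : Measurable b) {m : ℤ → ℂ} {A : ℝ≥0∞} (hA : A ≠ ∞)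
    (hmp : ShellOsc p b m A) (hmq : ShellOsc q b m A) {s : ℝ} (hs : 0 < s)
    (hs' : s < expSum p) :
    ∃ C : ℝ≥0∞, C ≠ ∞ ∧ ∀ (g : Rn n → ℝ≥0∞), Measurable g → ∀ D : ℝ≥0∞,
      (∀ r : ℝ, 0 < r → mixedENorm p ((ball (0 : Rn n) r).indicator g) ≤
        D * ENNReal.ofReal r ^ s) →
      ∀ r : ℝ, 0 < r → mixedENorm p ((ball (0 : Rn n) r).indicator (majorant b g)) ≤
        C * D * ENNReal.ofReal r ^ s := by
  have hp0 : ∀ i, 0 < p i := fun i => (hpq i).pos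
  have hn' : expSum p < n := by
    rw [← expSum_add_conj hpq]
    linarith [expSum_pos hn fun i => (hpq i).symm.pos]
  obtain ⟨C, hC, h⟩ := exists_majorant_shell_le hn hpq hb hA hmp hmq
  obtain ⟨W, hW, hsum⟩ := exists_tsum_shell_le hs
  have hK := tsum_shellKernel_ne_top (n := n) hs' (by linarith)
  set K := ∑' m : ℤ, shellKernel n (expSum p) m * pow2 (-(m * s)) with hKdef
  refine ⟨C * K * pow2 s * W, ENNReal.mul_ne_top (ENNReal.mul_ne_top (ENNReal.mul_ne_top hC hK)
    (pow2_ne_top s)) hW, fun g hg D hD r hr => ?_⟩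
  have hF : ∀ j : ℤ, mixedENorm p ((shell j : Set (Rn n)).indicator g) ≤
      D * (pow2 s * pow2 (j * s)) := by
    intro j
    refine (mixedENorm_mono hp0 fun x => indicator_le_indicator_of_subset (shell_subset_ball j)
      (fun _ => zero_le) x).trans ((hD _ (by positivity)).trans (le_of_eq ?_))
    rw [ofReal_two_rpow, pow2_rpow, ← pow2_add]
    congr 2
    ring
  have hT : ∀ k : ℤ, mixedENorm p ((shell k : Set (Rn n)).indicator (majorant b g)) ≤
      C * K * pow2 s * D * pow2 (k * s) := by
    intro k
    calc _ ≤ C * ∑' j : ℤ, shellKernel n (expSum p) (k - j) * (D * (pow2 s * pow2 (j * s))) := by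
          refine (h g hg k).trans ?_
          gcongr with j
          exact hF j
      _ = C * ∑' j : ℤ, (shellKernel n (expSum p) (k - j) * pow2 (-((k - j : ℤ) * s))) *
          (D * pow2 s * pow2 (k * s)) := by
          congr 1
          refine tsum_congr fun j => ?_
          have e : pow2 (j * s) = pow2 (-((k - j : ℤ) * s)) * pow2 (k * s) := by
            rw [← pow2_add]
            congr 1
            push_cast
            ring
          rw [e]
          ring
      _ = _ := by
          rw [ENNReal.tsum_mul_right,
            tsum_sub_left (fun m : ℤ => shellKernel n (expSum p) m * pow2 (-(m * s))) k]
          ring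
  obtain ⟨k, hk1, hk2⟩ := exists_dyadic hr
  refine (mixedENorm_ball_le_tsum hn (fun i => (hpq i).lt) (measurable_majorant hb hg) r).trans
    ((hsum _ (C * K * pow2 s * D) k r hk2.le fun j _ => (hT j).trans ?_).trans ?_)
  · gcongr
    -- `hT` has no linear factor; the one expected by `hsum` is at least 1 and may be inserted.
    exact le_mul_of_one_le_left' le_self_add
  · calc _ ≤ C * K * pow2 s * D * W * ENNReal.ofReal r ^ s := by
          gcongr
          rw [← pow2_rpow, ← ofReal_two_rpow]
          exact ENNReal.rpow_le_rpow (ENNReal.ofReal_le_ofReal hk1) hs.le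
      _ = _ := by ring

theorem mixedENorm_eq_iSup_ball (hp : ∀ i, 0 < p i) {g : Rn n → ℝ≥0∞} (hg : Measurable g) :
    mixedENorm p g = ⨆ k : ℕ, mixedENorm p ((ball (0 : Rn n) (k + 1)).indicator g) := by
  rw [← mixedENorm_iSup hp fun k => hg.indicator measurableSet_ball]
  · congr 1
    ext x
    refine le_antisymm ?_ (iSup_le fun k => indicator_le_self _ _ _)
    obtain ⟨k, hk⟩ := exists_nat_gt ‖x‖
    have hx : x ∈ ball (0 : Rn n) (k + 1) := by rw [mem_ball_zero_iff]; linarith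
    exact le_trans (by rw [indicator_of_mem hx]) (le_iSup _ k)
  · intro i j hij x
    refine indicator_le_indicator_of_subset (ball_subset_ball ?_) (fun _ => zero_le) x
    have : (i : ℝ) ≤ j := by exact_mod_cast hij
    linarith

/-- For one common exponent the norm is an ordinary Lebesgue norm, whose r-th power is additive over
disjoint shells. -/
theorem rpow_mixedENorm_const_eq_tsum (hn : 1 ≤ n) {r : ℝ} (hr : 0 < r) {g : Rn n → ℝ≥0∞}
    (hg : Measurable g) :
    mixedENorm (fun _ => r) g ^ r =
      ∑' j : ℤ, mixedENorm (fun _ => r) ((shell j : Set (Rn n)).indicator g) ^ r := by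
  have key : ∀ h : Rn n → ℝ≥0∞, Measurable h →
      mixedENorm (fun _ => r) h ^ r = ∫⁻ x, h x ^ r := by
    intro h hh
    rw [mixedENorm_const_exponent hr hh, ← ENNReal.rpow_mul, one_div_mul_cancel hr.ne',
      ENNReal.rpow_one]
  rw [key g hg, lintegral_eq_tsum_shell hn (hg.pow_const r)]
  refine tsum_congr fun j => ?_
  rw [key _ (hg.indicator (measurableSet_shell j)), ← lintegral_indicator (measurableSet_shell j)]
  congr 1
  ext x
  by_cases hx : x ∈ (shell j : Set (Rn n)) <;> simp [hx, hr]

/-- The case of growth exponent 0: geometric growth is unavailable, so the shell norms are summed in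
ℓ^r and the convolution is bounded by Young's inequality. -/
theorem exists_majorant_le_of_const (hn : 1 ≤ n) {r : ℝ} {q : Fin n → ℝ}
    (hpq : ∀ i, r.HolderConjugate (q i))
    {b : Rn n → ℂ} (hb : Measurable b) {m : ℤ → ℂ} {A : ℝ≥0∞} (hA : A ≠ ∞)
    (hmp : ShellOsc (fun _ => r) b m A) (hmq : ShellOsc q b m A) :
    ∃ C : ℝ≥0∞, C ≠ ∞ ∧ ∀ (g : Rn n → ℝ≥0∞), Measurable g →
      mixedENorm (fun _ => r) (majorant b g) ≤ C * mixedENorm (fun _ => r) g := by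
  have hr : 1 < r := (hpq ⟨0, hn⟩).lt
  have hr0 : 0 < r := by linarith
  have hE : 0 < expSum fun _ : Fin n => r := expSum_pos hn fun _ => hr0
  have hn' : (expSum fun _ : Fin n => r) < n := by
    rw [← expSum_add_conj hpq]
    linarith [expSum_pos hn fun i => (hpq i).symm.pos]
  obtain ⟨C, hC, h⟩ := exists_majorant_shell_le hn hpq hb hA hmp hmq
  have hK := tsum_shellKernel_ne_top (n := n) hE (by linarith)
  simp only [mul_zero, neg_zero, pow2_zero, mul_one] at hK
  set K := ∑' m : ℤ, shellKernel n (expSum fun _ : Fin n => r) m with hKdef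
  refine ⟨C * K, ENNReal.mul_ne_top hC hK, fun g hg => ?_⟩
  refine (ENNReal.rpow_le_rpow_iff hr0).1 ?_
  rw [rpow_mixedENorm_const_eq_tsum hn hr0 (measurable_majorant hb hg),
    ENNReal.mul_rpow_of_nonneg _ _ hr0.le, ENNReal.mul_rpow_of_nonneg _ _ hr0.le,
    rpow_mixedENorm_const_eq_tsum hn hr0 hg, mul_assoc]
  refine le_trans ?_ (mul_le_mul_right (tsum_conv_rpow_le hr.le _ _) _)
  rw [← ENNReal.tsum_mul_left]
  refine ENNReal.tsum_le_tsum fun k => ?_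
  rw [← ENNReal.mul_rpow_of_nonneg _ _ hr0.le]
  exact ENNReal.rpow_le_rpow (h g hg k) hr0.le

/-- The norm over a fixed ball is at most the norm over any larger one, whose bound tends to 0 as
the radius grows. -/
theorem ae_eq_zero_of_mixedENorm_ball_le (hpq : ∀ i, (p i).HolderConjugate (q i))
    {g : Rn n → ℝ≥0∞} (hg : Measurable g) {s : ℝ} (hs : s < 0) {D : ℝ≥0∞} (hD : D ≠ ∞)
    (h : ∀ r : ℝ, 0 < r → mixedENorm p ((ball (0 : Rn n) r).indicator g) ≤
      D * ENNReal.ofReal r ^ s) : g =ᵐ[volume] fun _ => 0 := by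
  have hp0 : ∀ i, 0 < p i := fun i => (hpq i).pos
  have hlim : Filter.Tendsto (fun r : ℝ => D * ENNReal.ofReal r ^ s) Filter.atTop (nhds 0) := by
    have h1 : Filter.Tendsto (fun r : ℝ => ENNReal.ofReal (r ^ s)) Filter.atTop (nhds 0) := by
      have := ENNReal.tendsto_ofReal (tendsto_rpow_neg_atTop (y := -s) (by linarith))
      simpa using this
    have h2 : Filter.Tendsto (fun r : ℝ => D * ENNReal.ofReal (r ^ s)) Filter.atTop
        (nhds (D * 0)) := ENNReal.Tendsto.const_mul h1 (Or.inr hD)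
    rw [mul_zero] at h2
    refine h2.congr' ?_
    filter_upwards [Filter.eventually_gt_atTop 0] with r hr
    rw [ENNReal.ofReal_rpow_of_pos hr]
  have hzero : ∀ r : ℝ, 0 < r → mixedENorm p ((ball (0 : Rn n) r).indicator g) = 0 := by
    intro r hr
    refine le_antisymm (ge_of_tendsto hlim ?_) zero_le
    filter_upwards [Filter.eventually_ge_atTop r] with R hR
    exact (mixedENorm_mono hp0 fun x => indicator_le_indicator_of_subset (ball_subset_ball hR)
      (fun _ => zero_le) x).trans (h R (hr.trans_le hR))
  have key : ∀ k : ℕ, ∀ᵐ x : Rn n, x ∈ ball (0 : Rn n) (k + 1) → g x = 0 := by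
    intro k
    refine (ae_restrict_iff' measurableSet_ball).1 ((lintegral_eq_zero_iff hg).1 ?_)
    have := setLIntegral_le_mixedENorm hpq (measurableSet_ball (x := (0 : Rn n)) (ε := k + 1))
      hg.aemeasurable
    rw [hzero _ (by positivity), zero_mul] at this
    exact le_antisymm this zero_le
  filter_upwards [ae_all_iff.2 key] with x hx
  obtain ⟨k, hk⟩ := exists_nat_gt ‖x‖
  exact hx k (by rw [mem_ball_zero_iff]; linarith)

/-- The majorant preserves power growth of the local mixed norms. -/
theorem exists_majorant_ball_le (hn : 1 ≤ n) (hpq : ∀ i, (p i).HolderConjugate (q i))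
    {b : Rn n → ℂ} (hb : Measurable b) {m : ℤ → ℂ} {A : ℝ≥0∞} (hA : A ≠ ∞)
    (hmp : ShellOsc p b m A) (hmq : ShellOsc q b m A) {s : ℝ} (hs' : s < expSum p)
    (hs : s = 0 → ∀ i j, p i = p j) :
    ∃ C : ℝ≥0∞, C ≠ ∞ ∧ ∀ (g : Rn n → ℝ≥0∞), Measurable g → ∀ D : ℝ≥0∞, D ≠ ∞ →
      (∀ r : ℝ, 0 < r → mixedENorm p ((ball (0 : Rn n) r).indicator g) ≤
        D * ENNReal.ofReal r ^ s) →
      ∀ r : ℝ, 0 < r → mixedENorm p ((ball (0 : Rn n) r).indicator (majorant b g)) ≤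
        C * D * ENNReal.ofReal r ^ s := by
  have hp0 : ∀ i, 0 < p i := fun i => (hpq i).pos
  rcases lt_trichotomy s 0 with h | h | h
  -- Negative growth forces g = 0 a.e., so the majorant vanishes and the constant 0 works.
  · refine ⟨0, by simp, fun g hg D hD hgD r hr => ?_⟩
    rw [majorant_congr_ae (ae_eq_zero_of_mixedENorm_ball_le hpq hg h hD hgD), majorant_zero,
      indicator_zero, mixedENorm_zero hp0]
    exact zero_le
  -- A bound uniform over all balls is a bound on the global norm, by monotone convergence.
  · have hconst : p = fun _ => p ⟨0, hn⟩ := funext fun i => hs h i _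
    obtain ⟨C, hC, h1⟩ := exists_majorant_le_of_const (r := p ⟨0, hn⟩) hn
      (fun i => by rw [← hs h i]; exact hpq i) hb hA (hconst ▸ hmp) hmq
    refine ⟨C, hC, fun g hg D hD hgD r hr => ?_⟩
    simp only [h, ENNReal.rpow_zero, mul_one] at hgD ⊢
    calc _ ≤ mixedENorm p (majorant b g) :=
          mixedENorm_mono hp0 fun x => indicator_le_self _ _ _
      _ ≤ C * mixedENorm p g := by rw [hconst]; exact h1 g hg
      _ ≤ C * D := by
          gcongr
          rw [mixedENorm_eq_iSup_ball hp0 hg]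
          exact iSup_le fun k => hgD _ (by positivity)
  · obtain ⟨C, hC, h1⟩ := exists_majorant_ball_le_of_pos hn hpq hb hA hmp hmq h hs'
    exact ⟨C, hC, fun g hg D _ => h1 g hg D⟩

end Majorant

/-! ### Domination of the commutators by the majorant -/

section Commutator

variable {n : ℕ} {p q : Fin n → ℝ}

theorem hardy_congr_ae {f g : Rn n → ℂ} (h : f =ᵐ[volume] g) : hardy f = hardy g := by
  ext x
  rw [hardy, hardy, integral_congr_ae (ae_restrict_of_ae h)]

theorem dualHardy_congr_ae {f g : Rn n → ℂ} (h : f =ᵐ[volume] g) :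
    dualHardy f = dualHardy g := by
  ext x
  refine integral_congr_ae (ae_restrict_of_ae ?_)
  filter_upwards [h] with t ht using by rw [ht]

theorem HardyDefined.congr_ae {f g : Rn n → ℂ} (hf : HardyDefined f) (h : f =ᵐ[volume] g) :
    HardyDefined g :=
  fun x hx => (hf x hx).congr (ae_restrict_of_ae h)

theorem DualHardyDefined.congr_ae {f g : Rn n → ℂ} (hf : DualHardyDefined f)
    (h : f =ᵐ[volume] g) : DualHardyDefined g := by
  intro x hx
  refine (hf x hx).congr (ae_restrict_of_ae ?_)
  filter_upwards [h] with t ht using by rw [ht]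

theorem mixedNorm_congr_ae (hp : ∀ i, 0 < p i) {f g : Rn n → ℂ} (h : f =ᵐ[volume] g) :
    mixedNorm p f = mixedNorm p g := by
  rw [mixedNorm_eq, mixedNorm_eq]
  refine mixedENorm_congr_ae hp ?_
  filter_upwards [h] with x hx using by rw [hx]

theorem indicator_congr_ae {f g : Rn n → ℂ} (s : Set (Rn n)) (h : f =ᵐ[volume] g) :
    s.indicator f =ᵐ[volume] s.indicator g := by
  filter_upwards [h] with x hx
  by_cases hs : x ∈ s <;> simp [hs, hx]

theorem morreyNorm_congr_ae (hp : ∀ i, 0 < p i) (lam : ℝ) {f g : Rn n → ℂ}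
    (h : f =ᵐ[volume] g) : morreyNorm p lam f = morreyNorm p lam g := by
  unfold morreyNorm
  simp_rw [mixedNorm_congr_ae hp (indicator_congr_ae _ h)]

theorem MemMorrey.congr_ae (hp : ∀ i, 0 < p i) {lam : ℝ} {f g : Rn n → ℂ}
    (hf : MemMorrey p lam f) (h : f =ᵐ[volume] g) : MemMorrey p lam g :=
  ⟨hf.1.congr h, morreyNorm_congr_ae hp lam h ▸ hf.2⟩

theorem memCMO_congr_ae (hp : ∀ i, 0 < p i) {f g : Rn n → ℂ} (h : f =ᵐ[volume] g)
    (hf : MemCMO p f) : MemCMO p g := by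
  refine ⟨hf.1.congr h, lt_of_eq_of_lt ?_ hf.2⟩
  unfold cmoNorm
  refine iSup_congr fun r => iSup_congr fun hr => ?_
  have hav : ⨍ t in ball (0 : Rn n) r, g t = ⨍ t in ball (0 : Rn n) r, f t :=
    average_congr (ae_restrict_of_ae h.symm)
  congr 1
  refine mixedNorm_congr_ae hp (indicator_congr_ae _ ?_)
  filter_upwards [h] with x hx using by rw [hx, hav]

/-- Allows f and b to be replaced by Borel representatives: the operators see f only up to null
sets, while the factor b(x) outside them changes the commutator only on a null set. -/
theorem commutatorBounded_of_measurable (hp : ∀ i, 0 < p i) {lam : ℝ}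
    {T : (Rn n → ℂ) → Rn n → ℂ} {D : (Rn n → ℂ) → Prop}
    (hT : ∀ f g : Rn n → ℂ, f =ᵐ[volume] g → T f = T g)
    (hD : ∀ f g : Rn n → ℂ, f =ᵐ[volume] g → D f → D g)
    {b b' : Rn n → ℂ} (hb : b =ᵐ[volume] b')
    (h : ∃ C : ℝ≥0, ∀ f : Rn n → ℂ, Measurable f → MemMorrey p lam f →
      (D f ∧ D fun t => f t * b t) ∧ MemMorrey p lam (commutator T b f) ∧
      morreyNorm p lam (commutator T b f) ≤ C * morreyNorm p lam f) :
    CommutatorBounded T D b' p lam := by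
  obtain ⟨C, h⟩ := h
  refine ⟨C, fun f hf => ?_⟩
  obtain ⟨g, hg, hfg⟩ : ∃ g, Measurable g ∧ f =ᵐ[volume] g :=
    ⟨hf.1.mk f, hf.1.stronglyMeasurable_mk.measurable, hf.1.ae_eq_mk⟩
  obtain ⟨⟨h1, h2⟩, h3, h4⟩ := h g hg (hf.congr_ae hp hfg)
  have hmul : (fun t => g t * b t) =ᵐ[volume] fun t => f t * b' t := by
    filter_upwards [hfg, hb] with t h1 h2 using by rw [h1, h2]
  have hcomm : commutator T b g =ᵐ[volume] commutator T b' f := by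
    filter_upwards [hb] with x hx
    rw [commutator, commutator, hT _ _ hmul, hT _ _ hfg, hx]
  refine ⟨⟨hD _ _ hfg.symm h1, hD _ _ hmul h2⟩, h3.congr_ae hp hcomm, ?_⟩
  rwa [← morreyNorm_congr_ae hp lam hcomm, morreyNorm_congr_ae hp lam hfg]

theorem stronglyMeasurable_hardy {f : Rn n → ℂ} (hf : Measurable f) :
    StronglyMeasurable (hardy f) := by
  have hs : MeasurableSet {z : Rn n × Rn n | ‖z.2‖ < ‖z.1‖} :=
    measurableSet_lt measurable_snd.norm measurable_fst.norm
  have h : StronglyMeasurable fun x : Rn n => ∫ t : Rn n,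
      {z : Rn n × Rn n | ‖z.2‖ < ‖z.1‖}.indicator (fun z => f z.2) (x, t) :=
    ((hf.comp measurable_snd).indicator hs).stronglyMeasurable.integral_prod_right'
  have e : hardy f = fun x => (‖x‖ ^ n)⁻¹ • ∫ t : Rn n,
      {z : Rn n × Rn n | ‖z.2‖ < ‖z.1‖}.indicator (fun z => f z.2) (x, t) := by
    ext x
    rw [hardy, ← integral_indicator (measurableSet_lt measurable_norm measurable_const)]
    rfl
  rw [e]
  exact ((measurable_norm.pow_const n).inv.stronglyMeasurable).smul h

theorem stronglyMeasurable_dualHardy {f : Rn n → ℂ} (hf : Measurable f) :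
    StronglyMeasurable (dualHardy f) := by
  have hs : MeasurableSet {z : Rn n × Rn n | ‖z.1‖ ≤ ‖z.2‖} :=
    measurableSet_le measurable_fst.norm measurable_snd.norm
  have hg : Measurable fun t : Rn n => (‖t‖ ^ n)⁻¹ • f t :=
    (measurable_norm.pow_const n).inv.smul hf
  have h : StronglyMeasurable fun x : Rn n => ∫ t : Rn n,
      {z : Rn n × Rn n | ‖z.1‖ ≤ ‖z.2‖}.indicator
        (fun z => (‖z.2‖ ^ n)⁻¹ • f z.2) (x, t) :=
    ((hg.comp measurable_snd).indicator hs).stronglyMeasurable.integral_prod_right'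
  have e : dualHardy f = fun x => ∫ t : Rn n,
      {z : Rn n × Rn n | ‖z.1‖ ≤ ‖z.2‖}.indicator
        (fun z => (‖z.2‖ ^ n)⁻¹ • f z.2) (x, t) := by
    ext x
    rw [dualHardy, ← integral_indicator (measurableSet_le measurable_const measurable_norm)]
    rfl
  rw [e]
  exact h

theorem maxKernel_anti {x y : Rn n} (h : ‖y‖ ≤ ‖x‖) (t : Rn n) :
    maxKernel x t ≤ maxKernel y t := by
  have h' : ‖y‖ₑ ≤ ‖x‖ₑ := by
    rw [← ofReal_norm, ← ofReal_norm]
    exact ENNReal.ofReal_le_ofReal h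
  exact ENNReal.inv_le_inv.2 (pow_le_pow_left' (sup_le_sup_right h' _) n)

/-- An a.e. finite majorant is finite at some y with |y| < |x|. The kernel only decreases when y is
replaced by x, and 1 + |b(t)| ≤ (1 + |b(y)|)(1 + |b(y) - b(t)|). This turns a.e. finiteness into
absolute convergence at every x ≠ 0, and is the reason for the summand 1 in `majorant`. -/
theorem lintegral_weight_lt_top {b f : Rn n → ℂ}
    (hfin : ∀ᵐ x, majorant b (fun t => ‖f t‖ₑ) x < ∞) {x : Rn n} (hx : x ≠ 0) :
    ∫⁻ t, (1 + ‖b t‖ₑ) * ‖f t‖ₑ * maxKernel x t < ∞ := by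
  obtain ⟨y, hy, hyx⟩ := (Measure.dense_of_ae hfin).exists_mem_open isOpen_ball
    (⟨0, mem_ball_self (norm_pos_iff.2 hx)⟩ : (ball (0 : Rn n) ‖x‖).Nonempty)
  have hyx' : ‖y‖ ≤ ‖x‖ := (mem_ball_zero_iff.1 hyx).le
  refine lt_of_le_of_lt ?_ (ENNReal.mul_lt_top (a := 1 + ‖b y‖ₑ)
    (ENNReal.add_lt_top.2 ⟨ENNReal.one_lt_top, enorm_lt_top⟩) hy)
  rw [majorant, ← lintegral_const_mul' _ _ (by simp)]
  refine lintegral_mono fun t => ?_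
  have h1 : 1 + ‖b t‖ₑ ≤ (1 + ‖b y‖ₑ) * (1 + ‖b y - b t‖ₑ) := by
    have : ‖b t‖ₑ ≤ ‖b y‖ₑ + ‖b y - b t‖ₑ := by
      conv_lhs => rw [show b t = b y - (b y - b t) by ring]
      exact enorm_sub_le
    calc _ ≤ 1 + (‖b y‖ₑ + ‖b y - b t‖ₑ) := add_le_add le_rfl this
      _ ≤ 1 + (‖b y‖ₑ + ‖b y - b t‖ₑ) + ‖b y‖ₑ * ‖b y - b t‖ₑ := le_self_add
      _ = _ := by ring
  calc _ ≤ ((1 + ‖b y‖ₑ) * (1 + ‖b y - b t‖ₑ)) * ‖f t‖ₑ * maxKernel y t :=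
        mul_le_mul' (mul_le_mul' h1 le_rfl) (maxKernel_anti hyx' t)
    _ = _ := by ring

/-- Covers both operators: w is |x|^(-n) on {|t| < |x|} or |t|^(-n) on {|t| ≥ |x|}, in each case
equal to the max kernel. The commutator is then ∫ w(t)(b(x) - b(t))f(t) over A. -/
theorem commutator_integral_le {A : Set (Rn n)} (hA : MeasurableSet A) {w : Rn n → ℝ}
    (hw : Measurable w) {x : Rn n} (hwk : ∀ t ∈ A, ‖w t‖ₑ = maxKernel x t) {b f : Rn n → ℂ}
    (hb : Measurable b) (hf : Measurable f)
    (hfin : ∫⁻ t, (1 + ‖b t‖ₑ) * ‖f t‖ₑ * maxKernel x t < ∞) :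
    IntegrableOn (fun t => w t • f t) A ∧ IntegrableOn (fun t => w t • (f t * b t)) A ∧
      ‖b x * (∫ t in A, w t • f t) - ∫ t in A, w t • (f t * b t)‖ₑ ≤
        majorant b (fun t => ‖f t‖ₑ) x := by
  have hint : ∀ g : Rn n → ℂ, Measurable g → (∀ t, ‖g t‖ₑ ≤ (1 + ‖b t‖ₑ) * ‖f t‖ₑ) →
      IntegrableOn (fun t => w t • g t) A := by
    intro g hg hle
    refine ⟨(hw.smul hg).aestronglyMeasurable, lt_of_le_of_lt ?_ hfin⟩
    refine le_trans (setLIntegral_mono_ae' hA (.of_forall fun t ht => ?_))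
      (setLIntegral_le_lintegral A _)
    rw [enorm_smul, hwk t ht, mul_comm]
    exact mul_le_mul' (hle t) le_rfl
  have h1 := hint f hf fun t => le_mul_of_one_le_left' le_self_add
  have h2 := hint (fun t => f t * b t) (hf.mul hb) fun t => by
    rw [enorm_mul, mul_comm]
    exact mul_le_mul' le_add_self le_rfl
  refine ⟨h1, h2, ?_⟩
  rw [← integral_const_mul, ← integral_sub (h1.const_mul (b x)) h2]
  refine (enorm_integral_le_lintegral_enorm _).trans (le_trans
    (setLIntegral_mono_ae' hA (.of_forall fun t ht => ?_)) (setLIntegral_le_lintegral A _))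
  have e : b x * (w t • f t) - w t • (f t * b t) = w t • ((b x - b t) * f t) := by
    simp only [Complex.real_smul]
    ring
  rw [e, enorm_smul, hwk t ht, enorm_mul, mul_comm]
  exact mul_le_mul' (mul_le_mul' le_add_self le_rfl) le_rfl

theorem enorm_inv_norm_pow {x : Rn n} (hx : x ≠ 0) : ‖(‖x‖ ^ n)⁻¹‖ₑ = (‖x‖ₑ ^ n)⁻¹ := by
  rw [enorm_inv (pow_ne_zero _ (norm_ne_zero_iff.2 hx)), enorm_pow, enorm_norm]

theorem enorm_le_enorm_of_norm_le {x y : Rn n} (h : ‖x‖ ≤ ‖y‖) : ‖x‖ₑ ≤ ‖y‖ₑ := by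
  rw [← ofReal_norm, ← ofReal_norm]
  exact ENNReal.ofReal_le_ofReal h

theorem hardy_commutator_le {b f : Rn n → ℂ} (hb : Measurable b) (hf : Measurable f)
    (hfin : ∀ᵐ x, majorant b (fun t => ‖f t‖ₑ) x < ∞) {x : Rn n} (hx : x ≠ 0) :
    IntegrableOn f {t : Rn n | ‖t‖ < ‖x‖} ∧
      IntegrableOn (fun t => f t * b t) {t : Rn n | ‖t‖ < ‖x‖} ∧
      ‖commutator hardy b f x‖ₑ ≤ majorant b (fun t => ‖f t‖ₑ) x := by
  have hA : MeasurableSet {t : Rn n | ‖t‖ < ‖x‖} :=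
    measurableSet_lt measurable_norm measurable_const
  have hc : (‖x‖ ^ n)⁻¹ ≠ 0 := inv_ne_zero (pow_ne_zero _ (norm_ne_zero_iff.2 hx))
  obtain ⟨h1, h2, h3⟩ := commutator_integral_le hA (w := fun _ => (‖x‖ ^ n)⁻¹) measurable_const
    (x := x) (fun t ht => by
      rw [enorm_inv_norm_pow hx, maxKernel, sup_eq_left.2 (enorm_le_enorm_of_norm_le (le_of_lt ht))])
    hb hf (lintegral_weight_lt_top hfin hx)
  rw [integral_smul, integral_smul] at h3
  exact ⟨(integrable_smul_iff hc f).1 h1, (integrable_smul_iff hc _).1 h2, h3⟩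

theorem dualHardy_commutator_le {b f : Rn n → ℂ} (hb : Measurable b) (hf : Measurable f)
    (hfin : ∀ᵐ x, majorant b (fun t => ‖f t‖ₑ) x < ∞) {x : Rn n} (hx : x ≠ 0) :
    IntegrableOn (fun t => (‖t‖ ^ n)⁻¹ • f t) {t : Rn n | ‖x‖ ≤ ‖t‖} ∧
      IntegrableOn (fun t => (‖t‖ ^ n)⁻¹ • (f t * b t)) {t : Rn n | ‖x‖ ≤ ‖t‖} ∧
      ‖commutator dualHardy b f x‖ₑ ≤ majorant b (fun t => ‖f t‖ₑ) x := by
  have hA : MeasurableSet {t : Rn n | ‖x‖ ≤ ‖t‖} :=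
    measurableSet_le measurable_const measurable_norm
  exact commutator_integral_le hA (w := fun t => (‖t‖ ^ n)⁻¹) (measurable_norm.pow_const n).inv
    (x := x) (fun t ht => by
      have ht0 : t ≠ 0 := norm_pos_iff.1 ((norm_pos_iff.2 hx).trans_le ht)
      rw [enorm_inv_norm_pow ht0, maxKernel, sup_eq_right.2 (enorm_le_enorm_of_norm_le ht)])
    hb hf (lintegral_weight_lt_top hfin hx)

/-- The commutators of both Hardy operators are bounded if the symbol oscillates little on
dyadic shells. -/
theorem commutatorBounded_of_shellOsc (hn : 1 ≤ n) (hpq : ∀ i, (p i).HolderConjugate (q i))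
    {b : Rn n → ℂ} (hb : Measurable b) {m : ℤ → ℂ} {A : ℝ≥0∞} (hA : A ≠ ∞)
    (hmp : ShellOsc p b m A) (hmq : ShellOsc q b m A) {lam : ℝ} (hlam : lam < 0)
    (hcrit : n * lam + expSum p = 0 → ∀ i j, p i = p j) :
    CommutatorBounded hardy HardyDefined b p lam ∧
      CommutatorBounded dualHardy DualHardyDefined b p lam := by
  have hp0 : ∀ i, 0 < p i := fun i => (hpq i).pos
  have hn0 : (0 : ℝ) < n := by exact_mod_cast hn
  obtain ⟨c1, hc1, h1⟩ := exists_ball_le_morreyNorm hn hp0 lam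
  obtain ⟨c2, hc2, h2⟩ := exists_morreyNorm_le hn hp0 lam
  -- The strict inequality s < `expSum p` is where λ < 0 enters.
  obtain ⟨C, hC, h⟩ := exists_majorant_ball_le hn hpq hb hA hmp hmq
    (s := n * lam + expSum p) (by nlinarith) hcrit
  have hK : c2 * (C * c1) ≠ ∞ := ENNReal.mul_ne_top hc2 (ENNReal.mul_ne_top hC hc1)
  have hball : ∀ f : Rn n → ℂ, Measurable f → MemMorrey p lam f → ∀ r : ℝ, 0 < r →
      mixedENorm p ((ball (0 : Rn n) r).indicator (majorant b fun t => ‖f t‖ₑ)) ≤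
        C * (c1 * morreyNorm p lam f) * ENNReal.ofReal r ^ (n * lam + expSum p) := by
    intro f hf hfm
    refine h _ hf.enorm _ (ENNReal.mul_ne_top hc1 hfm.2.ne) fun r hr => ?_
    exact (h1 f r hr).trans (le_of_eq (by ring))
  have hfin : ∀ f : Rn n → ℂ, Measurable f → MemMorrey p lam f →
      ∀ᵐ x, majorant b (fun t => ‖f t‖ₑ) x < ∞ := by
    intro f hf hfm
    refine ae_lt_top_of_mixedENorm_ball_ne_top hpq (measurable_majorant hb hf.enorm)
      fun r hr => ne_top_of_le_ne_top ?_ (hball f hf hfm r hr)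
    exact ENNReal.mul_ne_top (ENNReal.mul_ne_top hC (ENNReal.mul_ne_top hc1 hfm.2.ne))
      (ofReal_rpow_ne_top hr _)
  have hbound : ∀ f : Rn n → ℂ, Measurable f → MemMorrey p lam f → ∀ F : Rn n → ℂ,
      (∀ x, x ≠ 0 → ‖F x‖ₑ ≤ majorant b (fun t => ‖f t‖ₑ) x) →
      morreyNorm p lam F ≤ (c2 * (C * c1)).toNNReal * morreyNorm p lam f := by
    intro f hf hfm F hF
    rw [ENNReal.coe_toNNReal hK]
    refine (h2 F (C * (c1 * morreyNorm p lam f)) fun r hr => ?_).trans (le_of_eq (by ring))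
    refine le_trans (mixedENorm_mono_ae hp0 ?_) (hball f hf hfm r hr)
    filter_upwards [ae_ne_zero hn] with x hx
    exact indicator_le_indicator (hF x hx)
  have hmem : ∀ f : Rn n → ℂ, MemMorrey p lam f →
      ((c2 * (C * c1)).toNNReal : ℝ≥0∞) * morreyNorm p lam f < ∞ := fun f hfm =>
    ENNReal.mul_lt_top ENNReal.coe_lt_top hfm.2
  constructor
  · refine commutatorBounded_of_measurable hp0 (fun f g => hardy_congr_ae)
      (fun f g hfg hf => hf.congr_ae hfg) (Filter.EventuallyEq.refl _ b)
      ⟨(c2 * (C * c1)).toNNReal, fun f hf hfm => ?_⟩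
    have hx := fun x (hx : x ≠ 0) => hardy_commutator_le hb hf (hfin f hf hfm) hx
    have hle := hbound f hf hfm _ fun x h0 => (hx x h0).2.2
    exact ⟨⟨fun x h0 => (hx x h0).1, fun x h0 => (hx x h0).2.1⟩,
      ⟨((hb.stronglyMeasurable.mul (stronglyMeasurable_hardy hf)).sub
        (stronglyMeasurable_hardy (hf.mul hb))).aestronglyMeasurable,
        hle.trans_lt (hmem f hfm)⟩, hle⟩
  · refine commutatorBounded_of_measurable hp0 (fun f g => dualHardy_congr_ae)
      (fun f g hfg hf => hf.congr_ae hfg) (Filter.EventuallyEq.refl _ b)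
      ⟨(c2 * (C * c1)).toNNReal, fun f hf hfm => ?_⟩
    have hx := fun x (hx : x ≠ 0) => dualHardy_commutator_le hb hf (hfin f hf hfm) hx
    have hle := hbound f hf hfm _ fun x h0 => (hx x h0).2.2
    exact ⟨⟨fun x h0 => (hx x h0).1, fun x h0 => (hx x h0).2.1⟩,
      ⟨((hb.stronglyMeasurable.mul (stronglyMeasurable_dualHardy hf)).sub
        (stronglyMeasurable_dualHardy (hf.mul hb))).aestronglyMeasurable,
        hle.trans_lt (hmem f hfm)⟩, hle⟩

end Commutator

/-! ### Testing the Hardy commutator on single shells -/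

section Necessity

variable {n : ℕ} {p q : Fin n → ℝ}

/-- The unimodular factor with `phase z * z = ‖z‖`. -/
def phase (z : ℂ) : ℂ := (starRingEnd ℂ) z / (‖z‖ : ℂ)

theorem phase_mul_self (z : ℂ) : phase z * z = (‖z‖ : ℂ) := by
  rcases eq_or_ne z 0 with rfl | hz
  · simp
  · have : (‖z‖ : ℂ) ≠ 0 := by exact_mod_cast norm_ne_zero_iff.2 hz
    rw [phase, div_mul_eq_mul_div, Complex.conj_mul']
    field_simp

theorem enorm_phase_le (z : ℂ) : ‖phase z‖ₑ ≤ 1 := by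
  rw [← ofReal_norm, ← ENNReal.ofReal_one]
  refine ENNReal.ofReal_le_ofReal ?_
  rw [phase, norm_div, RCLike.norm_conj, Complex.norm_real, norm_norm]
  exact div_self_le_one _

theorem measurable_phase : Measurable phase :=
  Complex.continuous_conj.measurable.div (Complex.measurable_ofReal.comp measurable_norm)

/-- The phase makes the integrand real and nonnegative, so the absolute value of the integral loses
nothing. -/
theorem enorm_integral_phase {F : Rn n → ℝ≥0∞} (hFt : ∀ᵐ x, F x < ∞) {z : Rn n → ℂ}
    (hi : Integrable fun x => ((F x).toReal : ℂ) * phase (z x) * z x) :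
    ‖∫ x, ((F x).toReal : ℂ) * phase (z x) * z x‖ₑ = ∫⁻ x, F x * ‖z x‖ₑ := by
  have e : (fun x => ((F x).toReal : ℂ) * phase (z x) * z x) =
      fun x => (((F x).toReal * ‖z x‖ : ℝ) : ℂ) := by
    ext x
    rw [mul_assoc, phase_mul_self]
    push_cast
    rfl
  rw [e] at hi ⊢
  have hi' : Integrable fun x => (F x).toReal * ‖z x‖ := by
    simpa using hi.re
  have h0 : 0 ≤ᵐ[volume] fun x => (F x).toReal * ‖z x‖ := .of_forall fun x => by positivity
  rw [integral_complex_ofReal, ← ofReal_norm, Complex.norm_real,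
    Real.norm_of_nonneg (integral_nonneg_of_ae h0), ofReal_integral_eq_lintegral_ofReal hi' h0]
  refine lintegral_congr_ae ?_
  filter_upwards [hFt] with x hx
  rw [ENNReal.ofReal_mul ENNReal.toReal_nonneg, ENNReal.ofReal_toReal hx.ne, ofReal_norm]

/-- Balls of radius at most 2^k miss the shell, and for larger ones r^s ≥ 2^(ks) because s ≥ 0. -/
theorem exists_morreyNorm_shell_le (hn : 1 ≤ n) (hp : ∀ i, 0 < p i) {lam : ℝ}
    (hs : 0 ≤ n * lam + expSum p) :
    ∃ c : ℝ≥0∞, c ≠ ∞ ∧ ∀ (k : ℤ) (f : Rn n → ℂ), (∀ x ∉ (shell k : Set (Rn n)), f x = 0) →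
      morreyNorm p lam f ≤
        c * (pow2 (-(k * (n * lam + expSum p))) * mixedENorm p fun x => ‖f x‖ₑ) := by
  obtain ⟨c, hc, h⟩ := exists_morreyNorm_le hn hp lam
  refine ⟨c, hc, fun k f hf => h f _ fun r hr => ?_⟩
  rcases le_or_gt r (2 ^ (k : ℝ)) with hk | hk
  · have : ((ball (0 : Rn n) r).indicator fun x => ‖f x‖ₑ) = fun _ => 0 := by
      ext x
      by_cases hx : x ∈ ball (0 : Rn n) r
      · rw [indicator_of_mem hx, hf x, enorm_zero]
        intro hxk
        exact absurd ((mem_ball_zero_iff.1 hx).trans_le hk) (not_lt.2 hxk.1)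
      · simp [hx]
    rw [this, mixedENorm_zero hp]
    exact zero_le
  · have h1 : pow2 (k * (n * lam + expSum p)) ≤ ENNReal.ofReal r ^ (n * lam + expSum p) := by
      rw [← pow2_rpow, ← ofReal_two_rpow]
      exact ENNReal.rpow_le_rpow (ENNReal.ofReal_le_ofReal hk.le) hs
    calc mixedENorm p ((ball (0 : Rn n) r).indicator fun x => ‖f x‖ₑ)
        ≤ mixedENorm p fun x => ‖f x‖ₑ := mixedENorm_mono hp fun x => indicator_le_self _ _ _
      _ = pow2 (k * (n * lam + expSum p)) * pow2 (-(k * (n * lam + expSum p))) *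
          mixedENorm p fun x => ‖f x‖ₑ := by rw [pow2_mul_pow2_neg, one_mul]
      _ ≤ ENNReal.ofReal r ^ (n * lam + expSum p) * pow2 (-(k * (n * lam + expSum p))) *
          mixedENorm p fun x => ‖f x‖ₑ := by gcongr
      _ = _ := by rw [mul_comm (ENNReal.ofReal r ^ _), mul_right_comm]

theorem shell_subset_lt {k : ℤ} {x : Rn n} (hx : x ∈ (shell (k + 1) : Set (Rn n))) :
    (shell k : Set (Rn n)) ⊆ {t | ‖t‖ < ‖x‖} := by
  intro t ht
  have h := hx.1
  push_cast at h
  rw [← two_mul_two_rpow] at h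
  exact ht.2.trans_le h

theorem shell_ne_zero {k : ℤ} {x : Rn n} (hx : x ∈ (shell k : Set (Rn n))) : x ≠ 0 :=
  norm_pos_iff.1 ((by positivity : (0 : ℝ) < 2 ^ (k : ℝ)).trans_le hx.1)

/-- A bounded commutator is tested on functions living on one dyadic shell, and its values are
read off on the next one. -/
theorem exists_shell_test (hn : 1 ≤ n) (hp : ∀ i, 0 < p i) {b : Rn n → ℂ} {lam : ℝ}
    (hs : 0 ≤ n * lam + expSum p) (hbd : CommutatorBounded hardy HardyDefined b p lam) :
    ∃ c : ℝ≥0∞, c ≠ ∞ ∧ ∀ (k : ℤ) (f : Rn n → ℂ), Measurable f →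
      (∀ x ∉ (shell k : Set (Rn n)), f x = 0) → (mixedENorm p fun x => ‖f x‖ₑ) ≠ ∞ →
      Integrable f ∧ Integrable (fun x => f x * b x) ∧
        mixedENorm p ((shell (k + 1) : Set (Rn n)).indicator
          fun x => ‖b x * (∫ t, f t) - ∫ t, f t * b t‖ₑ) ≤
            c * (pow2 (k * n) * mixedENorm p fun x => ‖f x‖ₑ) := by
  obtain ⟨C, hC⟩ := hbd
  obtain ⟨c1, hc1, h1⟩ := exists_ball_le_morreyNorm hn hp lam
  obtain ⟨c2, hc2, h2⟩ := exists_morreyNorm_shell_le hn hp hs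
  set s := n * lam + expSum p with hsdef
  -- The factors 2^(2n) and 2^(2s) arise because the (k+1)-st shell has outer radius 2^(k+2).
  refine ⟨pow2 (2 * n) * (c1 * pow2 (2 * s)) * (C * c2), ENNReal.mul_ne_top
    (ENNReal.mul_ne_top (pow2_ne_top _) (ENNReal.mul_ne_top hc1 (pow2_ne_top _)))
    (ENNReal.mul_ne_top ENNReal.coe_ne_top hc2), fun k f hf hfk hft => ?_⟩
  have hM := h2 k f hfk
  have hmem : MemMorrey p lam f := ⟨hf.aestronglyMeasurable, hM.trans_lt
    (ENNReal.mul_lt_top hc2.lt_top (ENNReal.mul_lt_top (pow2_ne_top _).lt_top hft.lt_top))⟩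
  obtain ⟨⟨hD1, hD2⟩, hcm, hle⟩ := hC f hmem
  -- For x in the next shell, {|t| < |x|} contains the entire support of f, so the truncated
  -- integrals are full integrals.
  have hzero : ∀ {x : Rn n}, x ∈ (shell (k + 1) : Set (Rn n)) →
      ∀ t ∉ {t : Rn n | ‖t‖ < ‖x‖}, f t = 0 :=
    fun hx t ht => hfk t fun htk => ht (shell_subset_lt hx htk)
  have hint : ∀ {x : Rn n}, x ∈ (shell (k + 1) : Set (Rn n)) →
      Integrable f ∧ Integrable (fun t => f t * b t) := by
    intro x hx
    have hx0 := shell_ne_zero hx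
    constructor
    · refine (integrableOn_iff_integrable_of_support_subset fun t ht => ?_).1 (hD1 x hx0)
      by_contra h
      exact ht (hzero hx t h)
    · refine (integrableOn_iff_integrable_of_support_subset fun t ht => ?_).1 (hD2 x hx0)
      by_contra h
      exact ht (by simp [hzero hx t h])
  -- One point of the next shell suffices to turn the pointwise definedness of the operator into
  -- global integrability of f and fb.
  obtain ⟨x0, hx0⟩ : (shell (k + 1) : Set (Rn n)).Nonempty :=
    nonempty_of_measure_ne_zero (volume_shell_ne_zero hn (k + 1))
  refine ⟨(hint hx0).1, (hint hx0).2, ?_⟩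
  have hpt : ∀ x ∈ (shell (k + 1) : Set (Rn n)), ‖b x * (∫ t, f t) - ∫ t, f t * b t‖ₑ ≤
      pow2 ((k + 2) * n) * ‖commutator hardy b f x‖ₑ := by
    intro x hx
    have hxn : (‖x‖ ^ n : ℝ) ≠ 0 := pow_ne_zero _ (norm_ne_zero_iff.2 (shell_ne_zero hx))
    have e : b x * (∫ t, f t) - ∫ t, f t * b t = (‖x‖ ^ n) • commutator hardy b f x := by
      rw [commutator, hardy, hardy, setIntegral_eq_integral_of_forall_compl_eq_zero (hzero hx),
        setIntegral_eq_integral_of_forall_compl_eq_zero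
          (fun t ht => by rw [hzero hx t ht, zero_mul]), mul_smul_comm, ← smul_sub, smul_smul,
        mul_inv_cancel₀ hxn, one_smul]
    rw [e, enorm_smul, enorm_pow, enorm_norm]
    gcongr
    calc ‖x‖ₑ ^ n ≤ pow2 ((k + 1 : ℤ) + 1) ^ n := pow_le_pow_left' (enorm_le_pow2 hx) n
      _ = _ := by
        rw [← ENNReal.rpow_natCast, pow2_rpow]
        congr 2
        push_cast
        ring
  calc _ ≤ mixedENorm p fun x => pow2 ((k + 2) * n) *
        (ball (0 : Rn n) (2 ^ (((k + 1 : ℤ) : ℝ) + 1))).indicator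
          (fun x => ‖commutator hardy b f x‖ₑ) x := by
        refine mixedENorm_mono hp fun x => ?_
        by_cases hx : x ∈ (shell (k + 1) : Set (Rn n))
        · rw [indicator_of_mem hx, indicator_of_mem (shell_subset_ball _ hx)]
          exact hpt x hx
        · rw [indicator_of_notMem hx]
          exact zero_le
    _ = pow2 ((k + 2) * n) * mixedENorm p
        ((ball (0 : Rn n) (2 ^ (((k + 1 : ℤ) : ℝ) + 1))).indicator
          fun x => ‖commutator hardy b f x‖ₑ) :=
        mixedENorm_const_mul hp _ (hcm.1.enorm.indicator measurableSet_ball)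
    _ ≤ pow2 ((k + 2) * n) * (c1 * pow2 ((k + 2) * s) *
        (C * (c2 * (pow2 (-(k * s)) * mixedENorm p fun x => ‖f x‖ₑ)))) := by
        gcongr
        refine (h1 _ _ (by positivity)).trans (mul_le_mul' (le_of_eq ?_)
          (hle.trans (by gcongr)))
        rw [ofReal_two_rpow, pow2_rpow]
        congr 3
        push_cast
        ring
    _ = pow2 (2 * n) * (c1 * pow2 (2 * s)) * (C * c2) *
        (pow2 (k * n) * (pow2 (k * s) * pow2 (-(k * s))) * mixedENorm p fun x => ‖f x‖ₑ) := by
        rw [add_mul (k : ℝ) 2 (n : ℝ), add_mul (k : ℝ) 2 s, pow2_add, pow2_add]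
        ring
    _ = _ := by rw [pow2_mul_pow2_neg, mul_one]

/-- A measurable function tested by a bounded commutator is close, on each shell, to its average
on the preceding shell. -/
theorem exists_next_shell_osc_le (hn : 1 ≤ n) (hp : ∀ i, 0 < p i) {b : Rn n → ℂ}
    (hb : Measurable b) {lam : ℝ} (hs : 0 ≤ n * lam + expSum p)
    (hbd : CommutatorBounded hardy HardyDefined b p lam) :
    ∃ c : ℝ≥0∞, c ≠ ∞ ∧ ∀ k : ℤ,
      mixedENorm p ((shell (k + 1) : Set (Rn n)).indicator
        fun x => ‖b x - ⨍ t in shell k, b t‖ₑ) ≤ c * pow2 (k * expSum p) := by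
  obtain ⟨c1, hc1, h1⟩ := exists_shell_test hn hp hs hbd
  obtain ⟨c2, hc2, h2⟩ := exists_mixedENorm_shell_le hp
  obtain ⟨c3, hc3, h3⟩ := exists_pow2_le_volume_shell hn
  refine ⟨c3 * (c1 * c2), ENNReal.mul_ne_top hc3 (ENNReal.mul_ne_top hc1 hc2), fun k => ?_⟩
  have hSk := measurableSet_shell (n := n) k
  have hv := volume_shell_ne_top (n := n) k
  -- For this f, b(x)∫f - ∫fb is the volume of the shell times the deviation of b(x) from its
  -- average there.
  set f : Rn n → ℂ := (shell k : Set (Rn n)).indicator fun _ => 1 with hf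
  have hfe : (fun x => ‖f x‖ₑ) = (shell k : Set (Rn n)).indicator 1 := by
    ext x
    by_cases hx : x ∈ (shell k : Set (Rn n)) <;> simp [hf, hx]
  obtain ⟨-, -, h4⟩ := h1 k f (measurable_const.indicator hSk)
    (fun x hx => indicator_of_notMem hx _) (by
      rw [hfe]
      exact ne_top_of_le_ne_top (ENNReal.mul_ne_top hc2 (pow2_ne_top _)) (h2 k))
  have hi1 : ∫ t, f t = ((volume (shell k : Set (Rn n))).toReal : ℂ) := by
    rw [hf, integral_indicator hSk, setIntegral_const, Complex.real_smul, mul_one]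
    rfl
  have hi2 : ∫ t, f t * b t =
      ((volume (shell k : Set (Rn n))).toReal : ℂ) * ⨍ t in shell k, b t := by
    have : (fun t => f t * b t) = (shell k : Set (Rn n)).indicator b := by
      ext x
      by_cases hx : x ∈ (shell k : Set (Rn n)) <;> simp [hf, hx]
    rw [this, integral_indicator hSk, ← measure_smul_setAverage _ hv, Complex.real_smul]
    rfl
  rw [hi1, hi2, hfe] at h4
  have h5 : volume (shell k : Set (Rn n)) * mixedENorm p ((shell (k + 1) : Set (Rn n)).indicator
      fun x => ‖b x - ⨍ t in shell k, b t‖ₑ) ≤ c1 * (pow2 (k * n) * (c2 * pow2 (k * expSum p))) := by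
    rw [← mixedENorm_const_mul hp _ ((measurable_enorm_sub_const hb _).indicator
      (measurableSet_shell _)).aemeasurable]
    refine (mixedENorm_mono hp fun x => le_of_eq ?_).trans (h4.trans (by gcongr; exact h2 k))
    by_cases hx : x ∈ (shell (k + 1) : Set (Rn n))
    · rw [indicator_of_mem hx, indicator_of_mem hx, mul_comm (b x), ← mul_sub, enorm_mul]
      congr 1
      rw [← ofReal_norm, Complex.norm_real, Real.norm_of_nonneg ENNReal.toReal_nonneg,
        ENNReal.ofReal_toReal hv]
    · simp [hx]
  refine le_of_mul_pow2_le (s := k * n) ?_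
  calc _ ≤ mixedENorm p ((shell (k + 1) : Set (Rn n)).indicator
        fun x => ‖b x - ⨍ t in shell k, b t‖ₑ) * (c3 * volume (shell k : Set (Rn n))) := by
        gcongr; exact h3 k
    _ = c3 * (volume (shell k : Set (Rn n)) * mixedENorm p
        ((shell (k + 1) : Set (Rn n)).indicator fun x => ‖b x - ⨍ t in shell k, b t‖ₑ)) := by ring
    _ ≤ c3 * (c1 * (pow2 (k * n) * (c2 * pow2 (k * expSum p)))) := by gcongr
    _ = _ := by ring

/-- By duality it suffices to bound ∫ F|b - m| for F in the unit ball of the p-norm. With f = F ·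
phase(b - m) this is |∫ f(b - m)|, a number independent of x that is controlled on the next shell by
the commutator and by (b(x) - m)∫f; the latter is small in p-norm by `exists_next_shell_osc_le`. -/
theorem exists_dual_shell_osc_le (hn : 1 ≤ n) (hpq : ∀ i, (p i).HolderConjugate (q i))
    {b : Rn n → ℂ} (hb : Measurable b) {lam : ℝ} (hs : 0 ≤ n * lam + expSum p)
    (hbd : CommutatorBounded hardy HardyDefined b p lam) :
    ∃ c : ℝ≥0∞, c ≠ ∞ ∧ ∀ k : ℤ,
      mixedENorm q ((shell k : Set (Rn n)).indicator
        fun x => ‖b x - ⨍ t in shell k, b t‖ₑ) ≤ c * pow2 (k * expSum q) := by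
  have hp : ∀ i, 1 < p i := fun i => (hpq i).lt
  have hp0 : ∀ i, 0 < p i := fun i => (hpq i).pos
  obtain ⟨c1, hc1, h1⟩ := exists_shell_test hn hp0 hs hbd
  obtain ⟨c2, hc2, h2⟩ := exists_next_shell_osc_le hn hp0 hb hs hbd
  obtain ⟨c3, hc3, h3⟩ := exists_pow2_le_mixedENorm_shell hn hp0
  obtain ⟨c4, hc4, h4⟩ := exists_setLIntegral_shell_le hpq
  refine ⟨c3 * (c1 + c2 * c4) * pow2 (-expSum p), ENNReal.mul_ne_top (ENNReal.mul_ne_top hc3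
    (ENNReal.add_ne_top.2 ⟨hc1, ENNReal.mul_ne_top hc2 hc4⟩)) (pow2_ne_top _), fun k => ?_⟩
  have hSk := measurableSet_shell (n := n) k
  have hSk' := measurableSet_shell (n := n) (k + 1)
  set m := ⨍ t in shell k, b t with hm
  set z : Rn n → ℂ := fun x => b x - m with hz
  have hzm : Measurable z := hb.sub_const m
  refine mixedENorm_le_of_dual hpq (hzm.enorm.indicator hSk) (R := 2 * 2 ^ (k : ℝ))
    (fun x hx => indicator_of_notMem (fun h => absurd h.2 (not_lt.2 hx.le)) _)
    fun F hF hF0 hF1 => ?_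
  have hFk : ∀ x ∉ (shell k : Set (Rn n)), F x = 0 := fun x hx =>
    hF0 x (indicator_of_notMem hx _)
  have hFt : ∀ᵐ x, F x < ∞ := ae_lt_top_of_mixedENorm_ball_ne_top hpq hF fun r hr =>
    ne_top_of_le_ne_top ENNReal.one_ne_top
      ((mixedENorm_mono hp0 fun x => indicator_le_self _ _ _).trans hF1)
  set f : Rn n → ℂ := fun x => ((F x).toReal : ℂ) * phase (z x) with hf
  have hfm : Measurable f := (Complex.measurable_ofReal.comp hF.ennreal_toReal).mul
    (measurable_phase.comp hzm)
  have hfF : ∀ x, ‖f x‖ₑ ≤ F x := by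
    intro x
    rw [hf, enorm_mul, ← ofReal_norm ((F x).toReal : ℂ), Complex.norm_real,
      Real.norm_of_nonneg ENNReal.toReal_nonneg]
    calc _ ≤ F x * 1 := mul_le_mul' ENNReal.ofReal_toReal_le (enorm_phase_le _)
      _ = _ := mul_one _
  have hfN : (mixedENorm p fun x => ‖f x‖ₑ) ≤ 1 := (mixedENorm_mono hp0 hfF).trans hF1
  obtain ⟨hi1, hi2, h5⟩ := h1 k f hfm (fun x hx => by simp [hf, hFk x hx])
    (ne_top_of_le_ne_top ENNReal.one_ne_top hfN)
  have hi3 : Integrable fun x => f x * z x := by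
    have : (fun x => f x * z x) = fun x => f x * b x - f x * m := by
      ext x; rw [hz]; ring
    rw [this]
    exact hi2.sub (hi1.mul_const m)
  have hI : ∫ x, f x * z x = (∫ x, f x * b x) - (∫ x, f x) * m := by
    rw [← integral_mul_const, ← integral_sub hi2 (hi1.mul_const m)]
    refine integral_congr_ae (.of_forall fun x => ?_)
    simp only [hz]
    ring
  have hFG : ∫⁻ x, F x * (shell k : Set (Rn n)).indicator (fun x => ‖z x‖ₑ) x =
      ‖∫ x, f x * z x‖ₑ := by
    rw [enorm_integral_phase hFt hi3]
    refine lintegral_congr fun x => ?_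
    by_cases hx : x ∈ (shell k : Set (Rn n))
    · rw [indicator_of_mem hx]
    · simp [hFk x hx]
  have hf1 : ‖∫ x, f x‖ₑ ≤ c4 * pow2 (k * expSum q) := by
    calc _ ≤ ∫⁻ x, ‖f x‖ₑ := enorm_integral_le_lintegral_enorm _
      _ ≤ ∫⁻ x in shell k, F x := by
          rw [← lintegral_indicator hSk]
          refine lintegral_mono fun x => ?_
          by_cases hx : x ∈ (shell k : Set (Rn n))
          · rw [indicator_of_mem hx]; exact hfF x
          · rw [indicator_of_notMem hx, ← hFk x hx]
            exact hfF x
      _ ≤ c4 * (pow2 (k * expSum q) * 1) := by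
          refine (h4 F hF k).trans ?_
          gcongr
          exact (mixedENorm_mono hp0 fun x => indicator_le_self _ _ _).trans hF1
      _ = _ := by rw [mul_one]
  have hm1 : Measurable fun x => ‖b x * (∫ t, f t) - ∫ t, f t * b t‖ₑ :=
    ((hb.mul_const _).sub_const _).enorm
  -- The constant |∫ f(b - m)| is spread over the next shell, where its p-norm can be compared with
  -- that of functions of x.
  have hpt : ‖∫ x, f x * z x‖ₑ * mixedENorm p ((shell (k + 1) : Set (Rn n)).indicator 1) ≤
      c1 * (pow2 (k * n) * 1) + c4 * pow2 (k * expSum q) * (c2 * pow2 (k * expSum p)) := by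
    rw [← mixedENorm_const_mul hp0 _ (measurable_one.indicator hSk').aemeasurable]
    have h6 : Measurable ((shell (k + 1) : Set (Rn n)).indicator fun x => ‖b x - m‖ₑ) :=
      (measurable_enorm_sub_const hb m).indicator hSk'
    calc _ ≤ mixedENorm p fun x => (shell (k + 1) : Set (Rn n)).indicator
          (fun x => ‖b x * (∫ t, f t) - ∫ t, f t * b t‖ₑ) x +
          ‖∫ x, f x‖ₑ * (shell (k + 1) : Set (Rn n)).indicator (fun x => ‖b x - m‖ₑ) x := by
          refine mixedENorm_mono hp0 fun x => ?_
          by_cases hx : x ∈ (shell (k + 1) : Set (Rn n))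
          · simp only [indicator_of_mem hx, Pi.one_apply, mul_one]
            rw [hI, ← enorm_mul, ← enorm_neg ((∫ x, f x * b x) - (∫ x, f x) * m)]
            have e : -((∫ x, f x * b x) - (∫ x, f x) * m) =
                (b x * (∫ t, f t) - ∫ t, f t * b t) - (∫ x, f x) * (b x - m) := by ring
            rw [e]
            exact enorm_sub_le
          · simp [hx]
      _ ≤ _ := by
          refine (mixedENorm_add_le hp (hm1.indicator hSk').aemeasurable
            (h6.const_mul _).aemeasurable).trans (add_le_add (h5.trans ?_) ?_)
          · gcongr
          · rw [mixedENorm_const_mul hp0 _ h6.aemeasurable]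
            exact mul_le_mul' hf1 (h2 k)
  rw [hFG]
  refine le_of_mul_pow2_le (s := (k + 1 : ℤ) * expSum p) ?_
  calc _ ≤ ‖∫ x, f x * z x‖ₑ *
        (c3 * mixedENorm p ((shell (k + 1) : Set (Rn n)).indicator 1)) := by
        gcongr; exact h3 (k + 1)
    _ = c3 * (‖∫ x, f x * z x‖ₑ *
        mixedENorm p ((shell (k + 1) : Set (Rn n)).indicator 1)) := by ring
    _ ≤ c3 * (c1 * (pow2 (k * n) * 1) +
        c4 * pow2 (k * expSum q) * (c2 * pow2 (k * expSum p))) := by gcongr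
    _ = c3 * (c1 + c2 * c4) * (pow2 (k * expSum p) * pow2 (k * expSum q)) := by
        rw [← expSum_add_conj hpq, mul_add (k : ℝ), pow2_add]
        ring
    _ = _ := by
        rw [show ((k + 1 : ℤ) : ℝ) * expSum p = k * expSum p + expSum p by push_cast; ring,
          pow2_add, show c3 * (c1 + c2 * c4) * pow2 (-expSum p) * pow2 (k * expSum q) *
            (pow2 (k * expSum p) * pow2 (expSum p)) = c3 * (c1 + c2 * c4) *
            (pow2 (k * expSum p) * pow2 (k * expSum q)) *
            (pow2 (expSum p) * pow2 (-expSum p)) by ring, pow2_mul_pow2_neg, mul_one]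

/-- Boundedness of the Hardy commutator on one Morrey space controls the oscillation of the symbol
in both the mixed norm and its dual. -/
theorem exists_shellOsc_of_commutatorBounded (hn : 1 ≤ n)
    (hpq : ∀ i, (p i).HolderConjugate (q i)) {b : Rn n → ℂ} (hb : Measurable b) {lam : ℝ}
    (hs : 0 ≤ n * lam + expSum p) (hbd : CommutatorBounded hardy HardyDefined b p lam) :
    ∃ (m : ℤ → ℂ) (A : ℝ≥0∞), A ≠ ∞ ∧ ShellOsc p b m A ∧ ShellOsc q b m A := by
  have hp : ∀ i, 1 < p i := fun i => (hpq i).lt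
  have hp0 : ∀ i, 0 < p i := fun i => (hpq i).pos
  obtain ⟨c1, hc1, h1⟩ := exists_next_shell_osc_le hn hp0 hb hs hbd
  obtain ⟨c2, hc2, h2⟩ := exists_dual_shell_osc_le hn hpq hb hs hbd
  obtain ⟨c3, hc3, h3⟩ := exists_pow2_le_volume_shell hn
  obtain ⟨c4, hc4, h4⟩ := exists_mixedENorm_shell_le hp0
  obtain ⟨c5, hc5, h5⟩ := exists_mixedENorm_shell_le fun i => (hpq i).symm.pos
  set m : ℤ → ℂ := fun k => ⨍ t in shell k, b t with hm
  set B := c3 * (c1 * c5) * pow2 (-expSum p) with hB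
  have hBt : B ≠ ∞ := ENNReal.mul_ne_top (ENNReal.mul_ne_top hc3 (ENNReal.mul_ne_top hc1 hc5))
    (pow2_ne_top _)
  -- Integrate, by Hölder, the closeness of b on the (k+1)-st shell to the average of the k-th.
  have hdrift : ∀ k : ℤ, ‖m (k + 1) - m k‖ₑ ≤ B := by
    intro k
    have h6 := (enorm_setAverage_sub_mul_le (volume_shell_ne_top (k + 1)) hb (m k)).trans
      (setLIntegral_le_mixedENorm hpq (measurableSet_shell (k + 1))
        (measurable_enorm_sub_const hb (m k)).aemeasurable)
    refine le_of_mul_pow2_le (s := (k + 1 : ℤ) * n) ?_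
    calc _ ≤ ‖m (k + 1) - m k‖ₑ * (c3 * volume (shell (k + 1) : Set (Rn n))) := by
          gcongr; exact h3 (k + 1)
      _ = c3 * (‖m (k + 1) - m k‖ₑ * volume (shell (k + 1) : Set (Rn n))) := by ring
      _ ≤ c3 * (c1 * pow2 (k * expSum p) * (c5 * pow2 ((k + 1 : ℤ) * expSum q))) := by
          exact mul_le_mul' le_rfl (h6.trans (mul_le_mul' (h1 k) (h5 (k + 1))))
      _ = c3 * (c1 * c5) * pow2 (-expSum p + (k + 1 : ℤ) * n) := by
          have e : -expSum p + ((k + 1 : ℤ) : ℝ) * n =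
              k * expSum p + (k + 1 : ℤ) * expSum q := by
            rw [← expSum_add_conj hpq]
            push_cast
            ring
          rw [e, pow2_add]
          ring
      _ = _ := by rw [pow2_add, hB]; ring
  refine ⟨m, c1 + B * c4 + c2 + B, ?_, ⟨fun k => ?_, fun k => (hdrift k).trans le_add_self⟩,
    ⟨fun k => (h2 k).trans ?_, fun k => (hdrift k).trans le_add_self⟩⟩
  · simp [hc1, hc2, hBt, ENNReal.mul_ne_top hBt hc4]
  -- The p-oscillation is known only about the preceding average, so the index is shifted and the
  -- constant exchanged at the cost of one drift.
  · have h6 := h1 (k - 1)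
    have h7 := hdrift (k - 1)
    rw [sub_add_cancel] at h6 h7
    rw [enorm_sub_rev] at h7
    have h8 : pow2 ((k - 1 : ℤ) * expSum p) ≤ pow2 (k * expSum p) := by
      refine pow2_mono ?_
      push_cast
      nlinarith [expSum_nonneg hp0]
    calc _ ≤ c1 * pow2 (k * expSum p) + B * (c4 * pow2 (k * expSum p)) :=
          (mixedENorm_osc_le hp (measurableSet_shell k) hb (m (k - 1)) (m k)).trans
            (add_le_add (h6.trans (by gcongr)) (mul_le_mul' h7 (h4 k)))
      _ = (c1 + B * c4) * pow2 (k * expSum p) := by ring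
      _ ≤ _ := by
          rw [add_assoc]
          exact mul_le_mul' le_self_add le_rfl
  · gcongr
    exact le_add_self.trans le_self_add

end Necessity

/-! ### The growth exponent and the equivalence -/

section Main

variable {n : ℕ}

theorem holderConjugate_conj {p : Fin n → ℝ} (hp : ∀ i, 1 < p i) (i : Fin n) :
    (p i).HolderConjugate (conj p i) :=
  Real.HolderConjugate.conjExponent (hp i)

/-- Shows that the lower bound on λ means s > 0, and that λ is critical for an exponent vector
exactly when its s vanishes. -/
theorem add_expSum_eq (hn : 1 ≤ n) (lam : ℝ) (p : Fin n → ℝ) :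
    n * lam + expSum p = n * (lam - -(1 / (n : ℝ) * ∑ i, 1 / p i)) := by
  have : (n : ℝ) ≠ 0 := by positivity
  rw [expSum]
  field_simp
  ring

end Main

end MixedHardy

end

theorem theorem3p2 (n : ℕ) (hn : 1 ≤ n) (p : Fin n → ℝ) (hp : ∀ i, 1 < p i)
    (lam : ℝ) (hlam : -(1 / (n : ℝ) * ∑ i, 1 / p i) < lam) (hlam0 : lam < 0)
    (hcrit : lam = -(1 / (n : ℝ) * ∑ i, 1 / MixedHardy.conj p i) → ∀ i j, p i = p j)
    (b : MixedHardy.Rn n → ℂ) (hb : AEStronglyMeasurable b volume) :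
    (MixedHardy.MemCMO p b ∧ MixedHardy.MemCMO (MixedHardy.conj p) b) ↔
      ((MixedHardy.CommutatorBounded MixedHardy.hardy MixedHardy.HardyDefined b p lam ∧
        MixedHardy.CommutatorBounded MixedHardy.dualHardy MixedHardy.DualHardyDefined b p lam) ∧
       (MixedHardy.CommutatorBounded MixedHardy.hardy MixedHardy.HardyDefined b
          (MixedHardy.conj p) lam ∧
        MixedHardy.CommutatorBounded MixedHardy.dualHardy MixedHardy.DualHardyDefined b
          (MixedHardy.conj p) lam)) := by
  open MixedHardy in
  have hpq := holderConjugate_conj hp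
  have hqp : ∀ i, (conj p i).HolderConjugate (p i) := fun i => (hpq i).symm
  have hp0 : ∀ i, 0 < p i := fun i => (hpq i).pos
  have hq0 : ∀ i, 0 < conj p i := fun i => (hqp i).pos
  have hn0 : (0 : ℝ) < n := by exact_mod_cast hn
  have hpos : 0 < n * lam + expSum p := by
    rw [add_expSum_eq hn]
    exact mul_pos hn0 (by linarith)
  obtain ⟨b', hb', hbb⟩ : ∃ b', Measurable b' ∧ b =ᵐ[volume] b' :=
    ⟨hb.mk b, hb.stronglyMeasurable_mk.measurable, hb.ae_eq_mk⟩
  constructor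
  · rintro ⟨h1, h2⟩
    obtain ⟨A, hA, hoscp⟩ := exists_shellOsc_of_cmoNorm hn hp hb' (memCMO_congr_ae hp0 hbb h1).2
    obtain ⟨B, hB, hoscq⟩ := exists_shellOsc_of_cmoNorm hn (fun i => (hqp i).lt) hb'
      (memCMO_congr_ae hq0 hbb h2).2
    have hAB : max A B ≠ ∞ := by simp [hA, hB]
    replace hoscp := hoscp.mono (le_max_left A B)
    replace hoscq := hoscq.mono (le_max_right A B)
    -- For p the growth exponent is positive, so the critical case is void. For p' it may vanish,
    -- and then `hcrit` makes the conjugate exponents equal too.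
    have h3 := commutatorBounded_of_shellOsc hn hpq hb' hAB hoscp hoscq hlam0
      (fun h => absurd h hpos.ne')
    have h4 := commutatorBounded_of_shellOsc hn hqp hb' hAB hoscq hoscp hlam0 (fun h i j => by
      rw [add_expSum_eq hn] at h
      have h5 := (mul_eq_zero.1 h).resolve_left hn0.ne'
      rw [conj, conj, hcrit (sub_eq_zero.1 h5) i j])
    have key : ∀ {q : Fin n → ℝ}, (∀ i, 0 < q i) →
        CommutatorBounded hardy HardyDefined b' q lam ∧
          CommutatorBounded dualHardy DualHardyDefined b' q lam →
        CommutatorBounded hardy HardyDefined b q lam ∧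
          CommutatorBounded dualHardy DualHardyDefined b q lam := by
      rintro q hq ⟨⟨C, hC⟩, ⟨C', hC'⟩⟩
      exact ⟨commutatorBounded_of_measurable hq (fun f g => hardy_congr_ae)
        (fun f g hfg hf => hf.congr_ae hfg) hbb.symm ⟨C, fun f _ => hC f⟩,
        commutatorBounded_of_measurable hq (fun f g => dualHardy_congr_ae)
        (fun f g hfg hf => hf.congr_ae hfg) hbb.symm ⟨C', fun f _ => hC' f⟩⟩
    exact ⟨key hp0 h3, key hq0 h4⟩
  -- The p-space has positive growth exponent, hence contains the test functions; the p'-space may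
  -- consist of null functions only. One bounded commutator there controls both oscillations.
  · rintro ⟨⟨⟨C, hC⟩, -⟩, -⟩
    have h1 : CommutatorBounded hardy HardyDefined b' p lam :=
      commutatorBounded_of_measurable hp0 (fun f g => hardy_congr_ae)
        (fun f g hfg hf => hf.congr_ae hfg) hbb ⟨C, fun f _ => hC f⟩
    obtain ⟨m, A, hA, hoscp, hoscq⟩ :=
      exists_shellOsc_of_commutatorBounded hn hpq hb' hpos.le h1
    exact ⟨memCMO_congr_ae hp0 hbb.symm ⟨hb'.aestronglyMeasurable,
      cmoNorm_lt_top_of_shellOsc hn hpq hb' hA hoscp⟩,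
      memCMO_congr_ae hq0 hbb.symm ⟨hb'.aestronglyMeasurable,
      cmoNorm_lt_top_of_shellOsc hn hqp hb' hA hoscq⟩⟩
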